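/- Let $\mathbb P$ be the uniform probability measure on $(2^{\mathbb N})^{\mathbb N}$ (the product of fair coin measures). For $\omega=(\omega_0,\omega_1,\dots)\in(2^{\mathbb N})^{\mathbb N}$ write $\omega_{<n}=(\omega_0,\dots,\omega_{n-1})$, and for integrable $f$ put $\mathbb E_n(f)(\omega)=\int f(\omega_{<n}{}^\frown\xi)\,d\mathbb P(\xi)$. A *martingale* is a sequence of integrable functions $M_n:(2^{\mathbb N})^{\mathbb N}\to\mathbb R$ such that, almost surely, $M_n(\omega)$ depends only on $n$ and $\omega_{<n}$, and $\mathbb E_m(M_n)=M_m$ for all $m\le n$. It is a *computable martingale* if $M_n(\omega)$ is, for every $\omega$, computable uniformly from $n$ and $\omega_{<n}$. It is an *a.e. computable martingale* if there is a machine which, given $n$ and $\omega_{<n}$, outputs a fast Cauchy name of $M_n(\omega)$ whenever it produces an infinite output at all, and which, for each $n$, produces an infinite output for $\mathbb P$-almost every $\omega$. The point $\omega$ is *Doob random* if $(M_n(\omega))$ converges in $\mathbb R$ as $n\to\infty$ for every computable nonnegative martingale $(M_n)$. It is *Schnorr random* if $\bigoplus_n\omega_n\in 2^{\mathbb N}$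 is, i.e. $\bigoplus_n\omega_n\notin\bigcap_n U_n$ for every uniformly effectively open sequence $(U_n)$ of subsets of $2^{\mathbb N}$ whose fair coin measures $\mu(U_n)\le 2^{-n}$ are uniformly computable in $n$. **Theorem.** Let $\omega\in(2^{\mathbb N})^{\mathbb N}$ be Schnorr random. Then the following are equivalent: 1. $(M_n(\omega))$ diverges (has no limit in $\mathbb R$) as $n\to\infty$ for some computable nonnegative martingale $(M_n)$ with a computable bound on the growth, that is, a computable sequence of reals $d:\mathbb N\to\mathbb R$ such that $\|M_n\|_\infty\le d(n)$ for all $n$. 2. $\omega$ is not Doob random. 3. $(M_n(\omega))$ diverges as $n\to\infty$ for some a.e. computable nonnegative martingale $(M_n)$. -/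

import Mathlib

open MeasureTheory Filter Topology

namespace DoobRandom

/-! ### Computability of real numbers and of real-valued functionals of a bit sequence -/

/-- Cantor space, the space of infinite bit sequences. -/
abbrev Cantor : Type := ℕ → Bool

/-- The space of infinite sequences of infinite bit sequences. -/
abbrev CantorSeq : Type := ℕ → Cantor

/-- The enumeration of the rationals used by Cauchy names: the number coding the triple
`(a, b, c)` stands for `(a - b) / (c + 1)`. -/
def ratPoint (k : ℕ) : ℚ :=
  (((k.unpair.1.unpair.1 : ℕ) : ℚ) - ((k.unpair.1.unpair.2 : ℕ) : ℚ)) / ((k.unpair.2 : ℚ) + 1)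

/-- `x` is a Cauchy name of the real number `r`: the rationals it lists converge to `r`, and from
the `m`-th on they stay within distance `2⁻ᵐ` of the `m`-th. -/
def IsCauchyName (x : ℕ → ℕ) (r : ℝ) : Prop :=
  (∀ m n : ℕ, m ≤ n → |ratPoint (x n) - ratPoint (x m)| ≤ (1 / 2 : ℚ) ^ m) ∧
    Tendsto (fun n => (ratPoint (x n) : ℝ)) atTop (𝓝 r)

/-- A uniformly computable sequence of real numbers. -/
def IsComputableRealSeq (r : ℕ → ℝ) : Prop :=
  ∃ x : ℕ → ℕ → ℕ, Computable₂ x ∧ ∀ n, IsCauchyName (x n) (r n)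

/-- The finite bit string consisting of the first `s` bits of `α`. -/
def bitPrefix (α : Cantor) (s : ℕ) : List Bool := (List.range s).map α

/-- A procedure with an oracle reads the oracle tape from left to right; having read the bit string
`σ`, it asks for the next bit if `φ σ = none`, and halts with output `v` if `φ σ = some v`.
`HaltsWith φ α v` says that on the oracle `α` it halts with output `v`. -/
def HaltsWith (φ : List Bool → Option ℕ) (α : Cantor) (v : ℕ) : Prop :=
  ∃ s, φ (bitPrefix α s) = some v ∧ ∀ t < s, φ (bitPrefix α t) = none

/-- A machine with oracle that computes, uniformly in a parameter `n`, a partial map from Cantor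
space to Baire space: `φ n m` is the procedure for the `m`-th entry of the output. -/
def IsMachine (φ : ℕ → ℕ → List Bool → Option ℕ) : Prop :=
  Computable fun p : ℕ × ℕ × List Bool => φ p.1 p.2.1 p.2.2

/-- On parameter `n` and oracle `α` the machine `φ` produces the infinite output `x`. In particular
`(n, α)` is in the domain of the partial map computed by `φ` iff there is such an `x`. -/
def Produces (φ : ℕ → ℕ → List Bool → Option ℕ) (n : ℕ) (α : Cantor) (x : ℕ → ℕ) : Prop :=
  ∀ m, HaltsWith (φ n m) α (x m)

/-! ### The spaces, their uniform measures, and conditional expectation -/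

/-- The fair coin measure on `{0, 1}`. -/
noncomputable def coin : Measure Bool := (PMF.uniformOfFintype Bool).toMeasure

instance : IsProbabilityMeasure coin := by
  unfold coin; infer_instance

/-- The fair coin measure on Cantor space. -/
noncomputable def cantorMeasure : Measure Cantor := Measure.infinitePi fun _ => coin

instance : IsProbabilityMeasure cantorMeasure := by
  unfold cantorMeasure; infer_instance

/-- The uniform measure on sequences of bit sequences: the infinite product of the fair coin
measures on Cantor space. -/
noncomputable def unif : Measure CantorSeq := Measure.infinitePi fun _ => cantorMeasure

instance : IsProbabilityMeasure unif := by
  unfold unif; infer_instance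

/-- The computable isomorphism `ω ↦ ⨁ₙ ωₙ` onto Cantor space, by the pairing function. -/
def interleave (ω : CantorSeq) : Cantor := fun j => ω j.unpair.1 j.unpair.2

/-- The initial segment `ω_{<n}`, as a sequence of sequences padded with zeros. -/
def below (n : ℕ) (ω : CantorSeq) : CantorSeq := fun i => if i < n then ω i else fun _ => false

/-- The concatenation `ω_{<n} ⌢ ξ`. -/
def concat (n : ℕ) (ω ξ : CantorSeq) : CantorSeq := fun i => if i < n then ω i else ξ (i - n)

/-- The conditional expectation `𝔼ₙ(f)(ω) = ∫ f(ω_{<n} ⌢ ξ) dξ` of an integrable function. -/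
noncomputable def condExpAt (n : ℕ) (f : CantorSeq → ℝ) (ω : CantorSeq) : ℝ :=
  ∫ ξ, f (concat n ω ξ) ∂unif

/-! ### Martingales -/

/-- A martingale: integrable functions such that, almost surely, `Mₙ(ω)` depends only on `n` and
`ω_{<n}`, and `𝔼ₘ(Mₙ) = Mₘ` for `m ≤ n`. -/
structure IsMartingale (M : ℕ → CantorSeq → ℝ) : Prop where
  integrable : ∀ n, Integrable (M n) unif
  adapted : ∀ n, ∃ g : CantorSeq → ℝ, ∀ᵐ ω ∂unif, M n ω = g (below n ω)
  condExp : ∀ m n, m ≤ n → ∀ᵐ ω ∂unif, condExpAt m (M n) ω = M m ω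

/-- A computable martingale: `Mₙ(ω)` is computable (for every `ω`) uniformly from `n` and
`ω_{<n}`. -/
def IsComputableMartingale (M : ℕ → CantorSeq → ℝ) : Prop :=
  IsMartingale M ∧
    ∃ φ, IsMachine φ ∧
      ∀ n ω, ∃ x, Produces φ n (interleave (below n ω)) x ∧ IsCauchyName x (M n ω)

/-- An a.e. computable martingale: `Mₙ(ω)` is computed, uniformly from `n` and `ω_{<n}`, by a
machine whose domain has measure one for each `n`, and which outputs a name of `Mₙ(ω)` at *every*
point of its domain. (The values of `Mₙ` outside of the domain are irrelevant.) -/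
def IsAEComputableMartingale (M : ℕ → CantorSeq → ℝ) : Prop :=
  IsMartingale M ∧
    ∃ φ, IsMachine φ ∧
      (∀ n, ∀ᵐ ω ∂unif, ∃ x, Produces φ n (interleave (below n ω)) x) ∧
      ∀ n ω x, Produces φ n (interleave (below n ω)) x → IsCauchyName x (M n ω)

/-- The sequence of reals has a (finite) limit. -/
def Converges (r : ℕ → ℝ) : Prop := ∃ l : ℝ, Tendsto r atTop (𝓝 l)

/-! ### Randomness -/

/-- The `n`-th open set of the sequence described by a set of pairs (index, bit string): the union
of the cylinders `[σ]` with `W (n, σ)`. -/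
def openSet (W : ℕ × List Bool → Prop) (n : ℕ) : Set Cantor := {α | ∃ s, W (n, bitPrefix α s)}

/-- A Schnorr test: a computable sequence of effectively open sets (that is, given by a computably
enumerable set of pairs) whose measures are at most `2⁻ⁿ` and uniformly computable. -/
structure IsSchnorrTest (W : ℕ × List Bool → Prop) : Prop where
  re : REPred W
  measure_le : ∀ n, (cantorMeasure (openSet W n)).toReal ≤ (1 / 2 : ℝ) ^ n
  computable : IsComputableRealSeq fun n => (cantorMeasure (openSet W n)).toReal

/-- `ω` is Schnorr random if no Schnorr test on Cantor space captures `⨁ₙ ωₙ`. -/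
def IsSchnorrRandom (ω : CantorSeq) : Prop :=
  ∀ W, IsSchnorrTest W → interleave ω ∉ ⋂ n, openSet W n

/-- `ω` is Doob random if every computable nonnegative martingale converges on `ω`. -/
def IsDoobRandom (ω : CantorSeq) : Prop :=
  ∀ M, IsComputableMartingale M → (∀ n ξ, 0 ≤ M n ξ) → Converges fun n => M n ω

end DoobRandom

namespace DoobRandom

/-! ### Computability of list and string operations -/

section Comp

variable {α β σ : Type*} [Primcodable α] [Primcodable β] [Primcodable σ]

/-! The only substantial implication is from 3 to 1. Let `M` be nonnegative and a.e. computable and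
let `ω` be Schnorr random. The martingale is replaced by step functions whose values are exactly
computable from finite strings, and these are then corrected to a genuine martingale.

Approximation (`ComputesAE.exists_approximates`): running the machine for `Mₙ` on finitely many bits
of `ω_{<n}` gives a step function `sₙ ≤ Mₙ + 1` a.e., with value 0 where the machine has not halted
yet. The integral of `Mₙ + 1` is the constant `M₀ + 1`, which is computable, so a search finds a
number of bits for which the integral of `sₙ` falls short by only `O(4⁻ⁿ)`. The summand 1 makes
every unfinished oracle cost at least 1 in this deficit, so such oracles have measure `O(4⁻ⁿ)`.

Passing to `ω`: as `M` is a martingale, `sₙ - 𝔼ₙ(sₙ₊₁)` has `L¹` norm `O(4⁻ⁿ)`. Markov's inequality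
and an effective Borel–Cantelli lemma (`IsSchnorrRandom.eventually_not`) give `|sₙ - 𝔼ₙ(sₙ₊₁)| ≤
2⁻ⁿ` and `sₙ ≠ 0` at `ω` for large `n`. Hence these defects are summable at `ω`
(`Approximates.summable`), and `Mₙ + 1 - sₙ` tends to 0 there, so `sₙ` diverges with `Mₙ`
(`Approximates.not_converges`).

Correction: `compensated` starts at `C + s₀`, has increments `sₙ₊₁ - 𝔼ₙ(sₙ₊₁)`, and skips any that
could make it negative. For `C` above the sum of the defects nothing is skipped at `ω`, and there it
equals `C + sₙ` plus a convergent series (`compensated_eq`), so it diverges. Its values are dyadic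
and come from exact integer arithmetic; hence it is total computable, with a computable bound. -/

theorem computable_add {f g : α → ℕ} (hf : Computable f) (hg : Computable g) :
    Computable fun a => f a + g a := Primrec.nat_add.to_comp.comp hf hg

theorem computable_sub {f g : α → ℕ} (hf : Computable f) (hg : Computable g) :
    Computable fun a => f a - g a := Primrec.nat_sub.to_comp.comp hf hg

theorem computable_mul {f g : α → ℕ} (hf : Computable f) (hg : Computable g) :
    Computable fun a => f a * g a := Primrec.nat_mul.to_comp.comp hf hg

theorem computable_div {f g : α → ℕ} (hf : Computable f) (hg : Computable g) :
    Computable fun a => f a / g a := Primrec.nat_div.to_comp.comp hf hg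

theorem computable_pow {f g : α → ℕ} (hf : Computable f) (hg : Computable g) :
    Computable fun a => f a ^ g a :=
  (Primrec₂.unpaired'.1 Nat.Primrec.pow).to_comp.comp hf hg

theorem computable_le {f g : α → ℕ} (hf : Computable f) (hg : Computable g) :
    Computable fun a => decide (f a ≤ g a) :=
  (PrimrecPred.decide Primrec.nat_le).to_comp.comp (hf.pair hg)

theorem computable_lt {f g : α → ℕ} (hf : Computable f) (hg : Computable g) :
    Computable fun a => decide (f a < g a) :=
  (PrimrecPred.decide Primrec.nat_lt).to_comp.comp (hf.pair hg)

theorem computable_and {f g : α → Bool} (hf : Computable f) (hg : Computable g) :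
    Computable fun a => f a && g a := Primrec.and.to_comp.comp hf hg

theorem computable_or {f g : α → Bool} (hf : Computable f) (hg : Computable g) :
    Computable fun a => f a || g a := Primrec.or.to_comp.comp hf hg

/-- The fold is a recursion on the index `k` that looks up the `k`-th entry; after `k` rounds it
agrees with the fold over `take k`. -/
theorem computable_list_foldl {f : α → List β} {g : α → σ} {h : α → σ × β → σ}
    (hf : Computable f) (hg : Computable g) (hh : Computable₂ h) :
    Computable fun a => (f a).foldl (fun s b => h a (s, b)) (g a) := by
  have key : Computable fun a => (Nat.rec (g a)
      (fun k s => ((f a)[k]?.elim s fun b => h a (s, b))) (f a).length : σ) := by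
    refine Computable.nat_rec (h := fun a p => ((f a)[p.1]?.elim p.2 fun b => h a (p.2, b)))
      (Computable.list_length.comp hf) hg ?_
    have h1 : Computable fun p : α × ℕ × σ => (f p.1)[p.2.1]? :=
      Computable.list_getElem?.comp (hf.comp .fst) (Computable.fst.comp .snd)
    refine (Computable.option_casesOn (g := fun (p : α × ℕ × σ) b => h p.1 (p.2.2, b)) h1
      (Computable.snd.comp .snd) ?_).of_eq ?_
    · exact hh.comp (Computable.fst.comp .fst)
        ((Computable.snd.comp (Computable.snd.comp .fst)).pair .snd)
    · intro p
      dsimp only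
      cases (f p.1)[p.2.1]? <;> rfl
  refine key.of_eq fun a => ?_
  have : ∀ k ≤ (f a).length, (Nat.rec (g a)
      (fun k s => ((f a)[k]?.elim s fun b => h a (s, b))) k : σ) =
      ((f a).take k).foldl (fun s b => h a (s, b)) (g a) := by
    intro k
    induction k with
    | zero => intro _; simp
    | succ k ih =>
      intro hk
      have hk' : k < (f a).length := hk
      simp only [ih hk'.le]
      rw [List.take_add_one, List.getElem?_eq_getElem hk', List.foldl_append]
      simp
  simpa using this _ le_rfl

theorem computable_list_sum {f : α → List β} {g : α → β → ℕ}
    (hf : Computable f) (hg : Computable₂ g) :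
    Computable fun a => ((f a).map (g a)).sum := by
  have := computable_list_foldl (h := fun a (p : ℕ × β) => p.1 + g a p.2) hf
    (Computable.const (0 : ℕ)) (computable_add (Computable.fst.comp .snd)
      (hg.comp .fst (Computable.snd.comp .snd)))
  refine this.of_eq fun a => ?_
  rw [List.sum_eq_foldl, List.foldl_map]

/-- Whether `P k` holds for some `k < n`. -/
def existsLT (P : ℕ → Bool) (n : ℕ) : Bool := Nat.rec false (fun k b => b || P k) n

theorem existsLT_iff (P : ℕ → Bool) (n : ℕ) : existsLT P n = true ↔ ∃ k < n, P k = true := by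
  induction n with
  | zero => simp [existsLT]
  | succ n ih =>
    change (existsLT P n || P n) = true ↔ _
    rw [Bool.or_eq_true, ih]
    simp only [Nat.lt_succ_iff_lt_or_eq]
    constructor
    · rintro (⟨k, h, h'⟩ | h)
      exacts [⟨k, .inl h, h'⟩, ⟨n, .inr rfl, h⟩]
    · rintro ⟨k, h | rfl, h'⟩
      exacts [.inl ⟨k, h, h'⟩, .inr h']

theorem computable_existsLT {f : α → ℕ} {P : α → ℕ → Bool} (hf : Computable f)
    (hP : Computable₂ P) : Computable fun a => existsLT (P a) (f a) :=
  Computable.nat_rec (h := fun a p => p.2 || P a p.1) hf (.const false)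
    (computable_or (Computable.snd.comp .snd) (hP.comp .fst (Computable.fst.comp .snd)))

theorem computable_sum_range {f : α → ℕ} {g : α → ℕ → ℕ} (hf : Computable f)
    (hg : Computable₂ g) : Computable fun a => ∑ k ∈ Finset.range (f a), g a k := by
  refine (Computable.nat_rec (h := fun a (p : ℕ × ℕ) => p.2 + g a p.1) hf (.const 0)
    (computable_add (Computable.snd.comp .snd)
      (hg.comp .fst (Computable.fst.comp .snd)))).of_eq fun a => ?_
  induction f a with
  | zero => rfl
  | succ n ih => rw [Finset.sum_range_succ, ← ih]

/-- Unbounded search. The lengths of the strings inspected below are found this way: existence is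
proved by a limit argument, and computability then costs nothing. -/
theorem exists_computable_choice {P : α → ℕ → Bool} (hP : Computable₂ P)
    (h : ∀ a, ∃ n, P a n = true) : ∃ f : α → ℕ, Computable f ∧ ∀ a, P a (f a) = true :=
  ⟨_, Computable.find (P := fun a n => P a n = true)
    (Computable.computablePred (hP.of_eq fun p => by simp)) h, fun a => Nat.find_spec (h a)⟩

theorem rePred_exists {P : α → ℕ → Bool} (hP : Computable₂ P) :
    REPred fun a => ∃ n, P a n = true := by
  have h : Partrec fun a => Nat.rfind fun n => Part.some (P a n) := Partrec.rfind hP.partrec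
  refine h.dom_re.of_eq fun a => ?_
  refine Nat.rfind_dom.trans ?_
  constructor
  · rintro ⟨n, hn, _⟩
    exact ⟨n, (Part.mem_some_iff.1 hn).symm⟩
  · rintro ⟨n, hn⟩
    exact ⟨n, Part.mem_some_iff.2 hn.symm, fun _ => trivial⟩

end Comp

/-- The list of all bit strings of length `n`. -/
def strings (n : ℕ) : List (List Bool) :=
  Nat.rec [[]] (fun _ l => l.map (List.cons false) ++ l.map (List.cons true)) n

theorem strings_succ (n : ℕ) : strings (n + 1) =
    (strings n).map (List.cons false) ++ (strings n).map (List.cons true) := rfl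

theorem mem_strings {n : ℕ} {σ : List Bool} : σ ∈ strings n ↔ σ.length = n := by
  induction n generalizing σ with
  | zero => simp [strings]
  | succ n ih =>
    rw [strings_succ]
    rcases σ with _ | ⟨b, σ⟩
    · simp
    · cases b <;> simp [ih]

theorem strings_nodup (n : ℕ) : (strings n).Nodup := by
  induction n with
  | zero => simp [strings]
  | succ n ih =>
    rw [strings_succ]
    refine List.Nodup.append (ih.map (List.cons_injective)) (ih.map (List.cons_injective)) ?_
    intro σ h1 h2
    simp only [List.mem_map] at h1 h2
    obtain ⟨_, _, rfl⟩ := h1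
    obtain ⟨_, _, h⟩ := h2
    simp at h

theorem computable_strings : Computable strings := by
  refine Primrec.to_comp ?_
  refine Primrec.nat_rec₁ (f := fun _ (l : List (List Bool)) =>
    l.map (List.cons false) ++ l.map (List.cons true)) [[]] ?_
  have h : ∀ b : Bool, Primrec fun p : ℕ × List (List Bool) => p.2.map (List.cons b) := fun b =>
    Primrec.list_map .snd (Primrec.list_cons.comp (.const b) .snd)
  exact Primrec.list_append.comp (h false) (h true)

/-- The sum of `g` over all bit strings of length `n`. -/
def stringSum (n : ℕ) (g : List Bool → ℕ) : ℕ := ((strings n).map g).sum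

theorem computable_stringSum {α : Type*} [Primcodable α] {f : α → ℕ} {g : α → List Bool → ℕ}
    (hf : Computable f) (hg : Computable₂ g) : Computable fun a => stringSum (f a) (g a) :=
  computable_list_sum (computable_strings.comp hf) hg

/-- The string `τ` with the bits belonging to the coordinates below `n` replaced by those
of `σ`. -/
def mix (n : ℕ) (σ τ : List Bool) : List Bool :=
  (List.range τ.length).map fun j => if j.unpair.1 < n then σ.getD j false else τ.getD j false

theorem primrec_mix : Primrec fun p : ℕ × List Bool × List Bool => mix p.1 p.2.1 p.2.2 := by
  refine Primrec.list_map (g := fun (p : ℕ × List Bool × List Bool) j =>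
    if j.unpair.1 < p.1 then p.2.1.getD j false else p.2.2.getD j false)
    (Primrec.list_range.comp (Primrec.list_length.comp (Primrec.snd.comp .snd))) ?_
  refine Primrec.ite (Primrec.nat_lt.comp (Primrec.fst.comp (Primrec.unpair.comp .snd))
    (Primrec.fst.comp .fst)) ?_ ?_
  · exact (Primrec.list_getD false).comp (Primrec.fst.comp (Primrec.snd.comp .fst)) .snd
  · exact (Primrec.list_getD false).comp (Primrec.snd.comp (Primrec.snd.comp .fst)) .snd

/-- The string `σ` with the bits not belonging to the coordinates below `n` replaced by zeros. -/
def mask (n : ℕ) (σ : List Bool) : List Bool := mix n σ (σ.map fun _ => false)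

theorem computable_mask : Computable₂ mask := by
  refine Primrec.to_comp ?_
  exact primrec_mix.comp (Primrec.fst.pair (Primrec.snd.pair
    (Primrec.list_map .snd (.const false))))

theorem computable_mix {α : Type*} [Primcodable α] {f : α → ℕ} {g h : α → List Bool}
    (hf : Computable f) (hg : Computable g) (hh : Computable h) :
    Computable fun a => mix (f a) (g a) (h a) :=
  primrec_mix.to_comp.comp (hf.pair (hg.pair hh))

theorem computable_take {α : Type*} [Primcodable α] {f : α → ℕ} {g : α → List Bool}
    (hf : Computable f) (hg : Computable g) : Computable fun a => (g a).take (f a) :=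
  Primrec.list_take.to_comp.comp hf hg

/-! ### Prefixes -/

theorem bitPrefix_length (α : Cantor) (s : ℕ) : (bitPrefix α s).length = s := by
  simp [bitPrefix]

theorem bitPrefix_getD (α : Cantor) {s j : ℕ} (h : j < s) (b : Bool) :
    (bitPrefix α s).getD j b = α j := by
  simp [bitPrefix, List.getD, h]

theorem take_bitPrefix (α : Cantor) {s t : ℕ} (h : t ≤ s) :
    (bitPrefix α s).take t = bitPrefix α t := by
  simp [bitPrefix, ← List.map_take, List.take_range, h]

/-- The bit string consisting of the first `s` bits of `⨁ₙ ωₙ`. -/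
def pre (s : ℕ) (ω : CantorSeq) : List Bool := bitPrefix (interleave ω) s

theorem take_pre (ω : CantorSeq) {s t : ℕ} (h : t ≤ s) : (pre s ω).take t = pre t ω :=
  take_bitPrefix _ h

theorem length_pre (s : ℕ) (ω : CantorSeq) : (pre s ω).length = s := bitPrefix_length _ _

theorem mix_pre {n s t : ℕ} (h : t ≤ s) (ω ω' : CantorSeq) :
    mix n (pre s ω) (pre t ω') = pre t (fun i => if i < n then ω i else ω' i) := by
  unfold mix
  rw [length_pre]
  refine List.map_congr_left fun j hj => ?_
  rw [List.mem_range] at hj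
  rw [pre, pre, bitPrefix_getD _ (hj.trans_le h), bitPrefix_getD _ hj]
  simp only [interleave]
  split_ifs <;> rfl

theorem mask_pre (n s : ℕ) (ω : CantorSeq) : mask n (pre s ω) = pre s (below n ω) := by
  have : (pre s ω).map (fun _ => false) = pre s (fun _ _ => false) := by
    simp only [pre, bitPrefix, List.map_map]
    rfl
  rw [mask, this, mix_pre le_rfl]
  rfl

theorem below_below {m n : ℕ} (h : m ≤ n) (ω : CantorSeq) : below m (below n ω) = below m ω := by
  funext i
  simp only [below]
  split_ifs <;> first | rfl | omega

/-! ### Running a machine on a finite string -/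

/-- The output, if any, of the procedure `f` on an oracle with initial segment `σ`, if it halts
without asking for more bits. -/
def runOn (f : List Bool → Option ℕ) (σ : List Bool) : Option ℕ :=
  Nat.rec none (fun t (o : Option ℕ) => o <|> f (σ.take t)) (σ.length + 1)

theorem runOn_bitPrefix (f : List Bool → Option ℕ) (α : Cantor) (K v : ℕ) :
    runOn f (bitPrefix α K) = some v ↔
      ∃ s ≤ K, f (bitPrefix α s) = some v ∧ ∀ t < s, f (bitPrefix α t) = none := by
  -- Invariant of the loop: it holds either the output at the first halting prefix of length less
  -- than `k`, or `none` because no such prefix halts. The loop runs `K + 1` rounds so that the full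
  -- string is tried as well.
  have key : ∀ k ≤ K + 1, ∀ o : Option ℕ, (Nat.rec none
      (fun t (o : Option ℕ) => o <|> f ((bitPrefix α K).take t)) k : Option ℕ) = o ↔
      (∃ v s, o = some v ∧ s < k ∧ f (bitPrefix α s) = some v ∧
        ∀ t < s, f (bitPrefix α t) = none) ∨ (o = none ∧ ∀ t < k, f (bitPrefix α t) = none) := by
    intro k
    induction k with
    | zero => intro _ o; simp [eq_comm]
    | succ k ih =>
      intro hk o
      have hk' : k ≤ K := by omega
      have ih := ih (by omega)
      simp only [take_bitPrefix α hk'] at ih ⊢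
      generalize hr : (Nat.rec none
        (fun t (o : Option ℕ) => o <|> f ((bitPrefix α K).take t)) k : Option ℕ) = r at ih ⊢
      have ih' := (ih r).1 rfl
      rcases ih' with ⟨v, s, rfl, hs, h1, h2⟩ | ⟨rfl, h⟩
      · simp only [Option.orElse_eq_orElse, Option.orElse_some]
        constructor
        · rintro rfl
          exact .inl ⟨v, s, rfl, by omega, h1, h2⟩
        · rintro (⟨w, s', rfl, hs', h1', h2'⟩ | ⟨rfl, h⟩)
          · rcases lt_trichotomy s s' with h | rfl | h
            · rw [h2' s h] at h1; simp at h1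
            · rw [← h1, ← h1']
            · rw [h2 s' h] at h1'; simp at h1'
          · rw [h s (by omega)] at h1; simp at h1
      · simp only [Option.orElse_eq_orElse, Option.orElse_none]
        constructor
        · rintro rfl
          rcases h' : f (bitPrefix α k) with _ | v
          · refine .inr ⟨rfl, fun t ht => ?_⟩
            rcases Nat.lt_succ_iff_lt_or_eq.1 ht with ht | rfl
            exacts [h t ht, h']
          · exact .inl ⟨v, k, rfl, by omega, h', h⟩
        · rintro (⟨w, s', rfl, hs', h1', h2'⟩ | ⟨rfl, h⟩)
          · rcases Nat.lt_succ_iff_lt_or_eq.1 hs' with ht | rfl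
            · rw [h s' ht] at h1'; simp at h1'
            · exact h1'
          · exact h k (by omega)
  rw [runOn, bitPrefix_length, key (K + 1) le_rfl]
  simp

theorem HaltsWith.unique {f : List Bool → Option ℕ} {α : Cantor} {v w : ℕ}
    (hv : HaltsWith f α v) (hw : HaltsWith f α w) : v = w := by
  obtain ⟨s, h1, h2⟩ := hv
  obtain ⟨s', h1', h2'⟩ := hw
  rcases lt_trichotomy s s' with h | rfl | h
  · rw [h2' s h] at h1; simp at h1
  · rw [h1] at h1'; simpa using h1'
  · rw [h2 s' h] at h1'; simp at h1'

theorem Produces.unique {φ : ℕ → ℕ → List Bool → Option ℕ} {n : ℕ} {α : Cantor} {x y : ℕ → ℕ}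
    (hx : Produces φ n α x) (hy : Produces φ n α y) : x = y :=
  funext fun m => (hx m).unique (hy m)

theorem haltsWith_of_runOn {f : List Bool → Option ℕ} {α : Cantor} {K v : ℕ}
    (h : runOn f (bitPrefix α K) = some v) : HaltsWith f α v := by
  obtain ⟨s, _, h⟩ := (runOn_bitPrefix f α K v).1 h
  exact ⟨s, h⟩

theorem HaltsWith.exists_runOn {f : List Bool → Option ℕ} {α : Cantor} {v : ℕ}
    (h : HaltsWith f α v) : ∃ K, ∀ K' ≥ K, runOn f (bitPrefix α K') = some v := by
  obtain ⟨s, h⟩ := h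
  exact ⟨s, fun K hK => (runOn_bitPrefix f α K v).2 ⟨s, hK, h⟩⟩

/-- The output of the `m`-th procedure of the machine `φ` with parameter `n` on the oracle
`ω_{<n}`, if it halts after reading at most those bits that the initial segment `σ` of `⨁ₙ ωₙ`
gives. -/
def runBelow (φ : ℕ → ℕ → List Bool → Option ℕ) (n m : ℕ) (σ : List Bool) : Option ℕ :=
  runOn (φ n m) (mask n σ)

theorem computable_runOn {α : Type*} [Primcodable α] {f : α → List Bool → Option ℕ}
    {g : α → List Bool} (hf : Computable₂ f) (hg : Computable g) :
    Computable fun a => runOn (f a) (g a) := by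
  have h : Computable₂ fun (a : α) (q : ℕ × Option ℕ) => (q.2 <|> f a ((g a).take q.1)) :=
    Primrec.option_orElse.to_comp.comp (Computable.snd.comp .snd)
      (hf.comp .fst (computable_take (Computable.fst.comp .snd) (hg.comp .fst)))
  exact Computable.nat_rec (Computable.succ.comp (Computable.list_length.comp hg)) (.const none) h

theorem computable_runBelow {φ : ℕ → ℕ → List Bool → Option ℕ} (hφ : IsMachine φ) :
    Computable fun p : ℕ × ℕ × List Bool => runBelow φ p.1 p.2.1 p.2.2 := by
  refine computable_runOn (f := fun (p : ℕ × ℕ × List Bool) => φ p.1 p.2.1) ?_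
    (computable_mask.comp .fst (Computable.snd.comp .snd))
  exact hφ.comp ((Computable.fst.comp .fst).pair
    ((Computable.fst.comp (Computable.snd.comp .fst)).pair .snd))

theorem haltsWith_of_runBelow {φ : ℕ → ℕ → List Bool → Option ℕ} {n m K v : ℕ} {ω : CantorSeq}
    (h : runBelow φ n m (pre K ω) = some v) :
    HaltsWith (φ n m) (interleave (below n ω)) v := by
  rw [runBelow, mask_pre] at h
  exact haltsWith_of_runOn h

theorem HaltsWith.exists_runBelow {φ : ℕ → ℕ → List Bool → Option ℕ} {n m v : ℕ} {ω : CantorSeq}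
    (h : HaltsWith (φ n m) (interleave (below n ω)) v) :
    ∃ K, ∀ K' ≥ K, runBelow φ n m (pre K' ω) = some v := by
  obtain ⟨K, hK⟩ := h.exists_runOn
  exact ⟨K, fun K' h => by rw [runBelow, mask_pre]; exact hK K' h⟩

/-! ### The uniform measures -/

theorem measurable_interleave : Measurable interleave := by
  unfold interleave; fun_prop

theorem measurable_bitPrefix_comp {β : Type*} [MeasurableSpace β] (g : List Bool → β) (K : ℕ) :
    Measurable fun α : Cantor => g (bitPrefix α K) := by
  have h : (fun α : Cantor => g (bitPrefix α K)) =
      (fun x : Fin K → Bool => g (List.ofFn x)) ∘ fun (α : Cantor) (i : Fin K) => α i := by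
    funext α
    simp only [Function.comp, bitPrefix]
    congr 1
    apply List.ext_getElem <;> simp
  rw [h]
  exact Measurable.of_discrete.comp (by fun_prop)

theorem measurable_pre_comp {β : Type*} [MeasurableSpace β] (g : List Bool → β) (K : ℕ) :
    Measurable fun ω : CantorSeq => g (pre K ω) :=
  (measurable_bitPrefix_comp g K).comp measurable_interleave

theorem coin_singleton (b : Bool) : coin {b} = 1 / 2 := by
  rw [coin, PMF.toMeasure_apply_singleton _ _ (measurableSet_singleton b)]
  simp

/-- Currying identifies the iterated product with the product over `ℕ × ℕ`, and reindexing along the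
injection `Nat.unpair` preserves products. -/
theorem map_interleave : unif.map interleave = cantorMeasure := by
  have h := Measure.infinitePi_map_curry_symm (ι := ℕ) (κ := ℕ) (fun _ _ => coin)
  have h2 := Measure.map_infinitePi_infinitePi_of_inj (P := fun _ : ℕ × ℕ => coin)
    (f := Nat.unpair) Nat.pairEquiv.symm.injective
  rw [← h, Measure.map_map (by fun_prop) (by fun_prop)] at h2
  exact h2

theorem sum_strings {β : Type*} [AddCommMonoid β] (K : ℕ) (g : List Bool → β) :
    ((strings K).map g).sum = ∑ x : Fin K → Bool, g (List.ofFn x) := by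
  rw [← List.sum_toFinset _ (strings_nodup K)]
  refine (Finset.sum_bij (fun x _ => List.ofFn x) ?_ ?_ ?_ ?_).symm
  · intro x _; simp [mem_strings]
  · intro x _ y _ h; exact List.ofFn_injective h
  · intro σ hσ
    rw [List.mem_toFinset, mem_strings] at hσ
    subst hσ
    exact ⟨fun i => σ[i], Finset.mem_univ _, by simp⟩
  · intro _ _; rfl

/-- The first `K` bits are uniformly distributed on `Fin K → Bool`. Through this, integrals and
measures of prefix-dependent objects become finite sums that a machine can evaluate. -/
theorem integral_bitPrefix (K : ℕ) (g : List Bool → ℝ) :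
    ∫ α, g (bitPrefix α K) ∂cantorMeasure = ((strings K).map g).sum / 2 ^ K := by
  have h : ∀ α : Cantor, g (bitPrefix α K) =
      (fun x : Fin K → Bool => g (List.ofFn x)) (fun i : Fin K => α i) := by
    intro α
    simp only [bitPrefix]
    congr 1
    apply List.ext_getElem <;> simp
  have h2 := Measure.map_infinitePi_infinitePi_of_inj (P := fun _ : ℕ => coin)
    (f := fun i : Fin K => (i : ℕ)) Fin.val_injective
  have h3 := integral_map (μ := cantorMeasure) (φ := fun (α : Cantor) (i : Fin K) => α i)
    (f := fun x : Fin K → Bool => g (List.ofFn x))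
    (Measurable.aemeasurable (measurable_pi_lambda _ fun i => measurable_pi_apply _))
    (Measurable.of_discrete.aestronglyMeasurable)
  simp_rw [h]
  rw [← h3, cantorMeasure, h2, integral_fintype (Integrable.of_finite), sum_strings,
    Finset.sum_div]
  refine Finset.sum_congr rfl fun x _ => ?_
  rw [measureReal_def, Measure.infinitePi_singleton_of_fintype]
  simp [coin_singleton, div_eq_inv_mul]

theorem integral_pre (K : ℕ) (g : List Bool → ℝ) :
    ∫ ω, g (pre K ω) ∂unif = ((strings K).map g).sum / 2 ^ K := by
  rw [← integral_bitPrefix, ← map_interleave, integral_map measurable_interleave.aemeasurable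
    (measurable_bitPrefix_comp g K).aestronglyMeasurable]
  rfl

theorem integral_pre_nat (K : ℕ) (g : List Bool → ℕ) :
    ∫ ω, (g (pre K ω) : ℝ) ∂unif = stringSum K g / 2 ^ K := by
  rw [integral_pre K (fun σ => (g σ : ℝ)), stringSum, Nat.cast_list_sum, List.map_map]
  rfl

/-- The number of strings of length `K` with property `P`. -/
def stringCount (K : ℕ) (P : List Bool → Bool) : ℕ := stringSum K fun σ => (P σ).toNat

theorem computable_stringCount {α : Type*} [Primcodable α] {f : α → ℕ} {P : α → List Bool → Bool}
    (hf : Computable f) (hP : Computable₂ P) : Computable fun a => stringCount (f a) (P a) :=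
  computable_stringSum (g := fun a σ => (P a σ).toNat) hf
    ((Primrec.dom_bool Bool.toNat).to_comp.comp hP)

theorem cantorMeasure_bitPrefix (K : ℕ) (P : List Bool → Bool) :
    cantorMeasure.real {α | P (bitPrefix α K) = true} = stringCount K P / 2 ^ K := by
  have hm : MeasurableSet {α : Cantor | P (bitPrefix α K) = true} :=
    measurable_bitPrefix_comp P K (measurableSet_singleton true)
  rw [← integral_indicator_one hm, stringCount, stringSum, Nat.cast_list_sum, List.map_map,
    ← integral_bitPrefix]
  refine integral_congr_ae (.of_forall fun α => ?_)
  by_cases h : P (bitPrefix α K) = true <;> simp [Set.indicator, h]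

theorem unif_preimage_interleave {s : Set Cantor} (hs : MeasurableSet s) :
    unif.real (interleave ⁻¹' s) = cantorMeasure.real s := by
  rw [← map_interleave, measureReal_def, measureReal_def,
    Measure.map_apply measurable_interleave hs]

theorem unif_pre (K : ℕ) (P : List Bool → Bool) :
    unif.real {ω | P (pre K ω) = true} = stringCount K P / 2 ^ K := by
  rw [← cantorMeasure_bitPrefix, ← unif_preimage_interleave]
  · rfl
  · exact measurable_bitPrefix_comp P K (measurableSet_singleton true)

theorem integrable_pre (K : ℕ) (g : List Bool → ℝ) : Integrable (fun ω => g (pre K ω)) unif := by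
  refine Integrable.of_bound (C := ∑ σ ∈ (strings K).toFinset, ‖g σ‖)
    (measurable_pre_comp g K).aestronglyMeasurable (.of_forall fun ω => ?_)
  exact Finset.single_le_sum (f := fun σ => ‖g σ‖) (fun _ _ => norm_nonneg _)
    (by rw [List.mem_toFinset, mem_strings, length_pre])

/-! ### Concatenation and conditional expectation -/

theorem measurable_concat (n : ℕ) : Measurable fun p : CantorSeq × CantorSeq =>
    concat n p.1 p.2 := by
  refine measurable_pi_lambda _ fun i => ?_
  by_cases h : i < n
  · simp only [concat, if_pos h]; fun_prop
  · simp only [concat, if_neg h]; fun_prop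

/-- It suffices to check finite boxes. The preimage of a box is a product of two: one for the
coordinates below `n`, one for the others shifted down by `n`. Fubini for `condExpAt` rests on this.
-/
theorem measurePreserving_concat (n : ℕ) :
    MeasurePreserving (fun p : CantorSeq × CantorSeq => concat n p.1 p.2) (unif.prod unif) unif := by
  refine ⟨measurable_concat n, Measure.eq_infinitePi _ fun s t ht => ?_⟩
  rw [Measure.map_apply (measurable_concat n) (.pi s.countable_toSet fun i _ => ht i)]
  have h : (fun p : CantorSeq × CantorSeq => concat n p.1 p.2) ⁻¹' ((s : Set ℕ).pi t) =
      ((s.filter (· < n) : Finset ℕ) : Set ℕ).pi t ×ˢ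
        (((s.filter (¬ · < n)).image (· - n) : Finset ℕ) : Set ℕ).pi (fun i => t (i + n)) := by
    ext ⟨η, ξ⟩
    simp only [Set.mem_preimage, Set.mem_pi, Set.mem_prod, Finset.coe_image, Finset.coe_filter,
      Set.forall_mem_image, Set.mem_ofPred_eq, Finset.mem_coe, concat]
    constructor
    · intro h
      refine ⟨fun i hi => by simpa [hi.2] using h i hi.1, fun i hi => ?_⟩
      have := h i hi.1
      rw [if_neg hi.2] at this
      rwa [Nat.sub_add_cancel (not_lt.1 hi.2)]
    · rintro ⟨h1, h2⟩ i hi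
      split_ifs with h
      · exact h1 i ⟨hi, h⟩
      · have := h2 (x := i) ⟨hi, h⟩
        rwa [Nat.sub_add_cancel (not_lt.1 h)] at this
  rw [h, Measure.prod_prod]
  simp only [unif]
  rw [Measure.infinitePi_pi _ (fun i _ => ht i), Measure.infinitePi_pi _ (fun i _ => ht _),
    Finset.prod_image, ← Finset.prod_filter_mul_prod_filter_not s (· < n)]
  · congr 1
    refine Finset.prod_congr rfl fun i hi => ?_
    rw [Nat.sub_add_cancel (not_lt.1 (Finset.mem_filter.1 hi).2)]
  · intro i hi j hj hij
    simp only [Finset.coe_filter, Set.mem_ofPred_eq] at hi hj hij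
    omega

theorem ae_ae_concat (n : ℕ) {p : CantorSeq → Prop} (h : ∀ᵐ ω ∂unif, p ω) :
    ∀ᵐ ω ∂unif, ∀ᵐ ξ ∂unif, p (concat n ω ξ) :=
  Measure.ae_ae_of_ae_prod ((measurePreserving_concat n).quasiMeasurePreserving.ae h)

theorem integrable_comp_concat (n : ℕ) {f : CantorSeq → ℝ} (hf : Integrable f unif) :
    Integrable (fun p : CantorSeq × CantorSeq => f (concat n p.1 p.2)) (unif.prod unif) :=
  (measurePreserving_concat n).integrable_comp_of_integrable hf

theorem ae_integrable_concat (n : ℕ) {f : CantorSeq → ℝ} (hf : Integrable f unif) :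
    ∀ᵐ ω ∂unif, Integrable (fun ξ => f (concat n ω ξ)) unif :=
  (integrable_comp_concat n hf).prod_right_ae

theorem integrable_condExpAt (n : ℕ) {f : CantorSeq → ℝ} (hf : Integrable f unif) :
    Integrable (condExpAt n f) unif :=
  (integrable_comp_concat n hf).integral_prod_left

theorem integral_condExpAt (n : ℕ) {f : CantorSeq → ℝ} (hf : Integrable f unif) :
    ∫ ω, condExpAt n f ω ∂unif = ∫ ω, f ω ∂unif := by
  have h := integral_map (μ := unif.prod unif) (measurable_concat n).aemeasurable (f := f)
    (by rw [(measurePreserving_concat n).map_eq]; exact hf.1)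
  rw [(measurePreserving_concat n).map_eq, integral_prod _ (integrable_comp_concat n hf)] at h
  exact h.symm

theorem concat_concat {m n : ℕ} (h : m ≤ n) (ω ξ ξ' : CantorSeq) :
    concat n (concat m ω ξ) ξ' = concat m ω (concat (n - m) ξ ξ') := by
  funext i
  simp only [concat]
  split_ifs <;> first | rfl | omega | (congr 1; omega)

theorem below_concat {m n : ℕ} (h : m ≤ n) (ω ξ : CantorSeq) :
    below m (concat n ω ξ) = below m ω := by
  funext i
  simp only [below, concat]
  split_ifs <;> first | rfl | omega

theorem concat_below (n : ℕ) (ω ξ : CantorSeq) : concat n (below n ω) ξ = concat n ω ξ := by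
  funext i
  simp only [below, concat]
  split_ifs <;> rfl

theorem condExpAt_below {m n : ℕ} (h : m ≤ n) (f : CantorSeq → ℝ) (ω : CantorSeq) :
    condExpAt m f (below n ω) = condExpAt m f ω := by
  unfold condExpAt
  congr 1
  funext ξ
  rw [← concat_below, below_below h, concat_below]

/-- Tower property: resampling `ω_{<m} ⌢ ξ` after `n` amounts to resampling `ξ` after `n - m`, which
leaves the integral over `ξ` unchanged. -/
theorem condExpAt_condExpAt {m n : ℕ} (h : m ≤ n) {f : CantorSeq → ℝ} (ω : CantorSeq)
    (hf : Integrable (fun ξ => f (concat m ω ξ)) unif) :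
    condExpAt m (condExpAt n f) ω = condExpAt m f ω := by
  have := integral_condExpAt (n - m) hf
  rw [condExpAt, condExpAt, ← this]
  simp only [condExpAt, concat_concat h]

/-- `mix` discards the bits of `τ` at the coordinates below `n`, so averaging over all `τ` has the
same effect as averaging over fresh tails. The conditional expectation is thereby a finite
computation on a prefix of `⨁ₙ ωₙ`. -/
theorem condExpAt_pre {n K K' : ℕ} (h : K ≤ K') (g : List Bool → ℝ) (ω : CantorSeq) :
    condExpAt n (fun ω' => g (pre K ω')) ω =
      ((strings K).map fun τ => g (mix n (pre K' ω) τ)).sum / 2 ^ K := by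
  rw [← integral_pre K (fun τ => g (mix n (pre K' ω) τ)), ← integral_condExpAt n
    (integrable_pre K (fun τ => g (mix n (pre K' ω) τ)))]
  -- The coordinates of `η` below `n` are overwritten, so the integrand is constant in `η`.
  have : ∀ η : CantorSeq, condExpAt n (fun ω' => g (mix n (pre K' ω) (pre K ω'))) η =
      condExpAt n (fun ω' => g (pre K ω')) ω := by
    intro η
    unfold condExpAt
    congr 1
    funext ξ
    change g (mix n (pre K' ω) (pre K (concat n η ξ))) = g (pre K (concat n ω ξ))
    rw [mix_pre h]
    congr 2
    funext i
    simp only [concat]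
    split_ifs <;> rfl
  simp [this]

/-! ### Names of dyadic rationals -/

/-- The index of the rational `a / 2 ^ p`. -/
def dyadicCode (a p : ℕ) : ℕ := Nat.pair (Nat.pair a 0) (2 ^ p - 1)

theorem ratPoint_dyadicCode (a p : ℕ) : (ratPoint (dyadicCode a p) : ℝ) = a / 2 ^ p := by
  simp [ratPoint, dyadicCode, Nat.cast_sub Nat.one_le_two_pow]

theorem computable_dyadicCode {α : Type*} [Primcodable α] {f g : α → ℕ} (hf : Computable f)
    (hg : Computable g) : Computable fun a => dyadicCode (f a) (g a) := by
  have hp : Computable₂ Nat.pair := Primrec₂.natPair.to_comp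
  exact hp.comp (hp.comp hf (.const 0)) (computable_sub (computable_pow (.const 2) hg) (.const 1))

theorem isCauchyName_of_monotone {x : ℕ → ℕ} {r : ℝ} (h1 : ∀ t, (ratPoint (x t) : ℝ) ≤ r)
    (h2 : ∀ t, r ≤ ratPoint (x t) + (1 / 2) ^ t)
    (hm : Monotone fun t => (ratPoint (x t) : ℝ)) : IsCauchyName x r := by
  refine ⟨fun m n h => ?_, ?_⟩
  · have h3 : (ratPoint (x m) : ℝ) ≤ ratPoint (x n) := hm h
    have h4 : |(ratPoint (x n) : ℝ) - ratPoint (x m)| ≤ (1 / 2) ^ m := by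
      rw [abs_of_nonneg (by linarith)]
      linarith [h1 n, h2 m]
    rw [← Rat.cast_le (K := ℝ)]
    push_cast
    exact h4
  · have h0 : Tendsto (fun t : ℕ => (1 / 2 : ℝ) ^ t) atTop (𝓝 0) :=
      tendsto_pow_atTop_nhds_zero_of_lt_one (by norm_num) (by norm_num)
    refine tendsto_of_tendsto_of_tendsto_of_le_of_le (g := fun t => r - (1 / 2) ^ t)
      (h := fun _ => r) ?_ tendsto_const_nhds (fun t => by linarith [h2 t]) h1
    simpa using h0.const_sub r

theorem isCauchyName_dyadicCode (a p : ℕ) :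
    IsCauchyName (fun _ => dyadicCode a p) (a / 2 ^ p) :=
  isCauchyName_of_monotone (fun _ => (ratPoint_dyadicCode a p).le)
    (fun t => by rw [ratPoint_dyadicCode]; have : (0 : ℝ) < (1 / 2) ^ t := by positivity
                 linarith) monotone_const

theorem IsCauchyName.unique {x : ℕ → ℕ} {r s : ℝ} (hr : IsCauchyName x r)
    (hs : IsCauchyName x s) : r = s := tendsto_nhds_unique hr.2 hs.2

theorem IsCauchyName.abs_le {x : ℕ → ℕ} {r : ℝ} (h : IsCauchyName x r) (m : ℕ) :
    |r - ratPoint (x m)| ≤ (1 / 2) ^ m := by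
  have h1 : Tendsto (fun n => |(ratPoint (x n) : ℝ) - ratPoint (x m)|) atTop
      (𝓝 |r - ratPoint (x m)|) := (h.2.sub_const _).abs
  refine le_of_tendsto h1 ?_
  filter_upwards [eventually_ge_atTop m] with n hn
  have := (Rat.cast_le (K := ℝ)).2 (h.1 m n hn)
  push_cast at this
  exact this

/-! ### A Borel–Cantelli lemma for Schnorr randomness -/

section BorelCantelli

variable (P : ℕ → List Bool → Bool) (L : ℕ → ℕ)

/-- The union of the sets of oracles whose prefix of length `L k` has property `P k`, over the `t`
values of `k` above `n`. -/
def stageSet (n t : ℕ) : Set Cantor :=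
  {α | ∃ i < t, P (n + 1 + i) (bitPrefix α (L (n + 1 + i))) = true}

/-- The union of the sets of oracles whose prefix of length `L k` has property `P k`, over the
values of `k` above `n`. -/
def tailSet (n : ℕ) : Set Cantor :=
  {α | ∃ i, P (n + 1 + i) (bitPrefix α (L (n + 1 + i))) = true}

/-- A bound on the lengths of the prefixes that `stageSet` depends on. -/
def stageLength (n t : ℕ) : ℕ := ∑ i ∈ Finset.range t, L (n + 1 + i)

/-- The property of strings that describes `stageSet`. -/
def stagePred (n t : ℕ) (σ : List Bool) : Bool :=
  existsLT (fun i => P (n + 1 + i) (σ.take (L (n + 1 + i)))) t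

theorem stageSet_eq (n t : ℕ) :
    stageSet P L n t = {α | stagePred P L n t (bitPrefix α (stageLength L n t)) = true} := by
  ext α
  simp only [stageSet, stagePred, existsLT_iff, Set.mem_ofPred_eq]
  refine exists_congr fun i => and_congr_right fun hi => ?_
  rw [take_bitPrefix]
  exact Finset.single_le_sum (f := fun i => L (n + 1 + i)) (fun _ _ => Nat.zero_le _)
    (Finset.mem_range.2 hi)

theorem measure_tailSet_le (h : ∀ k, stringCount (L k) (P k) / 2 ^ L k ≤ (1 / 2 : ℝ) ^ k) (n : ℕ) :
    cantorMeasure.real (tailSet P L n) ≤ (1 / 2) ^ n := by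
  have h1 : tailSet P L n =
      ⋃ i, {α : Cantor | P (n + 1 + i) (bitPrefix α (L (n + 1 + i))) = true} := by
    ext α; simp [tailSet]
  -- Starting the union at `n + 1` makes the geometric series sum to exactly `2⁻ⁿ`.
  have h2 : HasSum (fun i : ℕ => (1 / 2 : ℝ) ^ (n + 1 + i)) ((1 / 2) ^ n) := by
    have := (hasSum_geometric_two).mul_left ((1 / 2 : ℝ) ^ (n + 1))
    rw [show (1 / 2 : ℝ) ^ (n + 1) * 2 = (1 / 2) ^ n by rw [pow_succ]; ring] at this
    simpa only [pow_add] using this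
  refine ENNReal.toReal_le_of_le_ofReal (by positivity) ?_
  rw [h1, ← h2.tsum_eq, ENNReal.ofReal_tsum_of_nonneg (fun i => by positivity) h2.summable]
  refine (measure_iUnion_le _).trans (ENNReal.tsum_le_tsum fun i => ?_)
  rw [ENNReal.le_ofReal_iff_toReal_le (measure_ne_top _ _) (by positivity)]
  exact (cantorMeasure_bitPrefix _ _).trans_le (h _)

variable {P L}

/-- The tail unions form a Schnorr test. Their measures are computable because the union of the
first `t` sets has a dyadic measure found by counting, and what remains has measure at most
`2⁻⁽ⁿ⁺ᵗ⁾`. Since `ω` avoids some tail union, all later properties fail. -/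
theorem IsSchnorrRandom.eventually_not {ω : CantorSeq} (hω : IsSchnorrRandom ω)
    (hP : Computable₂ P) (hL : Computable L)
    (h : ∀ k, stringCount (L k) (P k) / 2 ^ L k ≤ (1 / 2 : ℝ) ^ k) :
    ∃ k₀, ∀ k ≥ k₀, P k (pre (L k) ω) = false := by
  -- The two inequalities together demand length exactly `L k`, since `openSet` tries prefixes of
  -- every length.
  let D : ℕ × List Bool → ℕ → Bool := fun p i =>
    P (p.1 + 1 + i) p.2 && (decide (p.2.length ≤ L (p.1 + 1 + i)) &&
      decide (L (p.1 + 1 + i) ≤ p.2.length))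
  let W : ℕ × List Bool → Prop := fun p => ∃ i, D p i = true
  have hW : ∀ n, openSet W n = tailSet P L n := by
    intro n
    ext α
    simp only [openSet, W, D, tailSet, Bool.and_eq_true, decide_eq_true_eq, Set.mem_ofPred_eq,
      bitPrefix_length]
    constructor
    · rintro ⟨s, i, h1, h2, h3⟩
      obtain rfl := le_antisymm h2 h3
      exact ⟨i, h1⟩
    · rintro ⟨i, h1⟩
      exact ⟨_, i, h1, le_rfl, le_rfl⟩
  have hidx : Computable fun q : (ℕ × List Bool) × ℕ => q.1.1 + 1 + q.2 :=
    computable_add (computable_add (Computable.fst.comp .fst) (.const 1)) .snd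
  have hlen : Computable fun q : (ℕ × List Bool) × ℕ => q.1.2.length :=
    Computable.list_length.comp (Computable.snd.comp .fst)
  have hD : Computable₂ D := computable_and (hP.comp hidx (Computable.snd.comp .fst))
    (computable_and (computable_le hlen (hL.comp hidx)) (computable_le (hL.comp hidx) hlen))
  have hstage : ∀ n t, cantorMeasure.real (stageSet P L n t) =
      stringCount (stageLength L n t) (stagePred P L n t) / 2 ^ stageLength L n t := by
    intro n t
    rw [stageSet_eq, cantorMeasure_bitPrefix]
  have hidx' : Computable fun q : (ℕ × ℕ) × ℕ => q.1.1 + 1 + q.2 :=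
    computable_add (computable_add (Computable.fst.comp .fst) (.const 1)) .snd
  have hlength : Computable₂ (stageLength L) :=
    computable_sum_range (g := fun (q : ℕ × ℕ) i => L (q.1 + 1 + i)) .snd (hL.comp hidx')
  have hpred : Computable₂ fun (q : ℕ × ℕ) σ => stagePred P L q.1 q.2 σ := by
    refine computable_existsLT
      (P := fun (q : (ℕ × ℕ) × List Bool) i => P (q.1.1 + 1 + i) (q.2.take (L (q.1.1 + 1 + i))))
      (Computable.snd.comp .fst) ?_
    have : Computable fun q : ((ℕ × ℕ) × List Bool) × ℕ => q.1.1.1 + 1 + q.2 :=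
      computable_add (computable_add (Computable.fst.comp (Computable.fst.comp .fst)) (.const 1))
        .snd
    exact hP.comp this (computable_take (hL.comp this) (Computable.snd.comp .fst))
  have htest : IsSchnorrTest W := by
    refine ⟨rePred_exists hD, fun n => ?_, ?_⟩
    · rw [hW]; exact measure_tailSet_le P L h n
    · simp_rw [hW]
      refine ⟨fun n t => dyadicCode (stringCount (stageLength L n t) (stagePred P L n t))
        (stageLength L n t), computable_dyadicCode
          (computable_stringCount (P := fun (q : ℕ × ℕ) σ => stagePred P L q.1 q.2 σ)
            hlength hpred) hlength, fun n => ?_⟩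
      have hq : ∀ t, (ratPoint (dyadicCode (stringCount (stageLength L n t) (stagePred P L n t))
          (stageLength L n t)) : ℝ) = cantorMeasure.real (stageSet P L n t) := by
        intro t; rw [ratPoint_dyadicCode, hstage]
      refine isCauchyName_of_monotone (fun t => ?_) (fun t => ?_) ?_
      · rw [hq]
        exact measureReal_mono fun α ⟨i, _, h⟩ => ⟨i, h⟩
      · rw [hq]
        have hsub : tailSet P L n ⊆ stageSet P L n t ∪ tailSet P L (n + t) := by
          rintro α ⟨i, hi⟩
          by_cases hit : i < t
          · exact .inl ⟨i, hit, hi⟩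
          · refine .inr ⟨i - t, ?_⟩
            have : n + t + 1 + (i - t) = n + 1 + i := by omega
            rwa [this]
        have h1 := (measureReal_mono (μ := cantorMeasure) hsub).trans (measureReal_union_le _ _)
        have h2 := measure_tailSet_le P L h (n + t)
        have h3 : (1 / 2 : ℝ) ^ (n + t) ≤ (1 / 2) ^ t :=
          pow_le_pow_of_le_one (by norm_num) (by norm_num) (Nat.le_add_left _ _)
        change cantorMeasure.real _ ≤ _
        linarith
      · intro s t hst
        simp only [hq]
        exact measureReal_mono fun α ⟨i, hi, h⟩ => ⟨i, hi.trans_le hst, h⟩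
  have := hω W htest
  simp only [Set.mem_iInter, not_forall] at this
  obtain ⟨n, hn⟩ := this
  rw [hW] at hn
  refine ⟨n + 1, fun k hk => ?_⟩
  by_contra hc
  rw [Bool.not_eq_false] at hc
  refine hn ⟨k - (n + 1), ?_⟩
  rw [Nat.add_sub_cancel' hk]
  exact hc

end BorelCantelli

/-! ### A martingale from an almost-martingale -/

theorem condExpAt_mono_ae (n : ℕ) {f g : CantorSeq → ℝ} (hf : Integrable f unif)
    (hg : Integrable g unif) (h : ∀ᵐ ω ∂unif, f ω ≤ g ω) :
    ∀ᵐ ω ∂unif, condExpAt n f ω ≤ condExpAt n g ω := by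
  filter_upwards [ae_ae_concat n h, ae_integrable_concat n hf, ae_integrable_concat n hg]
    with ω h1 h2 h3
  exact integral_mono_ae h2 h3 h1

/-- Compare both functions with `F`: by monotonicity `condExpAt n s' ≤ condExpAt n F' = F` a.e., so
`F - s` and `F - condExpAt n s'` are nonnegative and dominate the absolute value by their sum. -/
theorem integral_abs_sub_condExpAt_le (n : ℕ) {F F' s s' : CantorSeq → ℝ}
    (hF : Integrable F unif) (hF' : Integrable F' unif) (hs : Integrable s unif)
    (hs' : Integrable s' unif) (h : ∀ᵐ ω ∂unif, s ω ≤ F ω) (h' : ∀ᵐ ω ∂unif, s' ω ≤ F' ω)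
    (hE : ∀ᵐ ω ∂unif, condExpAt n F' ω = F ω) :
    ∫ ω, |s ω - condExpAt n s' ω| ∂unif ≤
      (∫ ω, F ω ∂unif - ∫ ω, s ω ∂unif) + (∫ ω, F' ω ∂unif - ∫ ω, s' ω ∂unif) := by
  have hint := integrable_condExpAt n hs'
  have h1 : ∫ ω, |s ω - condExpAt n s' ω| ∂unif ≤
      ∫ ω, ((F ω - s ω) + (F ω - condExpAt n s' ω)) ∂unif := by
    refine integral_mono_ae (hs.sub hint).abs ((hF.sub hs).add (hF.sub hint)) ?_
    filter_upwards [h, hE, condExpAt_mono_ae n hs' hF' h'] with ω h1 h2 h3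
    rw [h2] at h3
    rw [abs_le]
    constructor <;> linarith
  rw [integral_add (f := fun ω => F ω - s ω) (g := fun ω => F ω - condExpAt n s' ω)
    (hF.sub hs) (hF.sub hint), integral_sub hF hs, integral_sub hF hint,
    integral_condExpAt n hs'] at h1
  have h2 : ∫ ω, F ω ∂unif = ∫ ω, F' ω ∂unif := by
    rw [← integral_condExpAt n hF']
    exact integral_congr_ae (hE.mono fun _ h => h.symm)
  linarith

open Classical in
/-- The martingale with increments `sₙ₊₁ - 𝔼ₙ(sₙ₊₁)` and initial value `C + s₀`, where an
increment is skipped if it might lead to a negative value. -/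
noncomputable def compensated (C : ℝ) (s : ℕ → CantorSeq → ℝ) : ℕ → CantorSeq → ℝ
  | 0, ω => C + s 0 ω
  | n + 1, ω => if condExpAt n (s (n + 1)) ω ≤ compensated C s n ω then
      compensated C s n ω - condExpAt n (s (n + 1)) ω + s (n + 1) ω else compensated C s n ω

section Compensated

variable {C : ℝ} {s : ℕ → CantorSeq → ℝ}

theorem compensated_nonneg (hC : 0 ≤ C) (h0 : ∀ n ω, 0 ≤ s n ω) (n : ℕ) (ω : CantorSeq) :
    0 ≤ compensated C s n ω := by
  induction n with
  | zero => exact add_nonneg hC (h0 0 ω)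
  | succ n ih =>
    rw [compensated]
    split_ifs with h
    · linarith [h0 (n + 1) ω]
    · exact ih

theorem compensated_le (h0 : ∀ n ω, 0 ≤ s n ω) {B : ℕ → ℝ}
    (hB : ∀ n ω, s n ω ≤ B n) (n : ℕ) (ω : CantorSeq) :
    compensated C s n ω ≤ C + ∑ k ∈ Finset.range (n + 1), B k := by
  induction n with
  | zero => simpa [compensated] using hB 0 ω
  | succ n ih =>
    rw [compensated, Finset.sum_range_succ]
    have h1 : 0 ≤ condExpAt n (s (n + 1)) ω := integral_nonneg fun _ => h0 _ _
    have h2 := hB (n + 1) ω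
    have h3 := h0 (n + 1) ω
    split_ifs <;> linarith

theorem compensated_below (hs : ∀ n ω, s n (below n ω) = s n ω) {m n : ℕ} (h : m ≤ n)
    (ω : CantorSeq) : compensated C s m (below n ω) = compensated C s m ω := by
  have hs' : ∀ m ≤ n, s m (below n ω) = s m ω := by
    intro m h
    rw [← hs m, below_below h, hs m]
  induction m with
  | zero => rw [compensated, compensated, hs' 0 h]
  | succ m ih =>
    rw [compensated, compensated, ih (by omega), hs' _ h, condExpAt_below (by omega)]

theorem measurable_condExpAt (n : ℕ) {f : CantorSeq → ℝ} (hf : Measurable f) :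
    Measurable (condExpAt n f) := by
  have : StronglyMeasurable fun p : CantorSeq × CantorSeq => f (concat n p.1 p.2) :=
    (hf.comp (measurable_concat n)).stronglyMeasurable
  exact this.integral_prod_right'.measurable

theorem measurable_compensated (hm : ∀ n, Measurable (s n)) (n : ℕ) :
    Measurable (compensated C s n) := by
  induction n with
  | zero => exact (hm 0).const_add C
  | succ n ih =>
    have h := measurable_condExpAt n (hm (n + 1))
    exact Measurable.ite (measurableSet_le h ih) ((ih.sub h).add (hm (n + 1))) ih

theorem integrable_of_le {f : CantorSeq → ℝ} (hf : Measurable f) (h0 : ∀ ω, 0 ≤ f ω) {b : ℝ}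
    (hb : ∀ ω, f ω ≤ b) : Integrable f unif :=
  Integrable.of_bound hf.aestronglyMeasurable b
    (.of_forall fun ω => by rw [Real.norm_of_nonneg (h0 ω)]; exact hb ω)

theorem condExpAt_eq_self {n : ℕ} {f : CantorSeq → ℝ} (h : ∀ ω, f (below n ω) = f ω)
    (ω : CantorSeq) : condExpAt n f ω = f ω := by
  have : ∀ ξ, f (concat n ω ξ) = f ω := by
    intro ξ
    rw [← h, below_concat le_rfl, h]
  simp [condExpAt, this]

/-- Whether an increment is skipped is decided by `ω_{<n}` alone, so conditionally on `ω_{<n}` the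
increment is either 0 or `sₙ₊₁` minus its mean. The one-step identity holds at every point and is
iterated by the tower property. -/
theorem isMartingale_compensated (hC : 0 ≤ C) (h0 : ∀ n ω, 0 ≤ s n ω)
    (hm : ∀ n, Measurable (s n)) (hs : ∀ n ω, s n (below n ω) = s n ω) {B : ℕ → ℝ}
    (hB : ∀ n ω, s n ω ≤ B n) : IsMartingale (compensated C s) := by
  have hc0 := compensated_nonneg hC h0
  have hcm := measurable_compensated (C := C) hm
  have hcB := compensated_le (C := C) h0 hB
  have hcb : ∀ n ω, compensated C s n (below n ω) = compensated C s n ω :=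
    fun n => compensated_below hs le_rfl
  refine ⟨fun n => integrable_of_le (hcm n) (hc0 n) (hcB n),
    fun n => ⟨compensated C s n, .of_forall fun ω => (hcb n ω).symm⟩, fun m n h => .of_forall ?_⟩
  have hstep : ∀ n, condExpAt n (compensated C s (n + 1)) = compensated C s n := by
    intro n
    funext ω
    have h1 : ∀ ξ, compensated C s n (concat n ω ξ) = compensated C s n ω := by
      intro ξ
      rw [← hcb, below_concat le_rfl, hcb]
    have h2 : ∀ ξ, condExpAt n (s (n + 1)) (concat n ω ξ) = condExpAt n (s (n + 1)) ω := by
      intro ξ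
      rw [← condExpAt_below le_rfl, below_concat le_rfl, condExpAt_below le_rfl]
    have hi : Integrable (fun ξ => s (n + 1) (concat n ω ξ)) unif :=
      integrable_of_le ((hm _).comp ((measurable_concat n).comp measurable_prodMk_left))
        (fun _ => h0 _ _) (fun _ => hB _ _)
    by_cases h : condExpAt n (s (n + 1)) ω ≤ compensated C s n ω
    · rw [condExpAt]
      simp only [compensated, h1, h2, if_pos h]
      rw [integral_add (integrable_const _) hi]
      simp [condExpAt]
    · rw [condExpAt]
      simp only [compensated, h1, h2, if_neg h]
      simp
  induction n, h using Nat.le_induction with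
  | base => exact condExpAt_eq_self (hcb m)
  | succ n h ih =>
    intro ω
    rw [← condExpAt_condExpAt h, hstep, ih]
    exact integrable_of_le ((hcm _).comp ((measurable_concat m).comp measurable_prodMk_left))
        (fun _ => hc0 _ _) (fun _ => hcB _ _)

/-- Under the formula for `n`, the skipping test reads `0 ≤ C + ∑_{k ≤ n} (sₖ - 𝔼ₖ(sₖ₊₁))`. The
hypothesis on `C` ensures this, so no increment is skipped at `ω`. -/
theorem compensated_eq {ω : CantorSeq} (hC : ∀ n, ∑ k ∈ Finset.range n,
    |s k ω - condExpAt k (s (k + 1)) ω| ≤ C) (n : ℕ) : compensated C s n ω =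
      C + s n ω + ∑ k ∈ Finset.range n, (s k ω - condExpAt k (s (k + 1)) ω) := by
  induction n with
  | zero => simp [compensated]
  | succ n ih =>
    have h1 := neg_le_of_abs_le ((Finset.abs_sum_le_sum_abs
      (fun k => s k ω - condExpAt k (s (k + 1)) ω) (Finset.range (n + 1))).trans (hC (n + 1)))
    rw [Finset.sum_range_succ] at h1
    rw [compensated, if_pos (by rw [ih]; linarith), ih, Finset.sum_range_succ]
    ring

/-- Once `C` exceeds the sum of the defects, the compensated martingale and `s` differ at `ω` by a
convergent sequence. A natural number `C` keeps the initial value dyadic. -/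
theorem exists_compensated_not_converges {ω : CantorSeq}
    (hsum : Summable fun k => |s k ω - condExpAt k (s (k + 1)) ω|)
    (h : ¬ Converges fun n => s n ω) :
    ∃ C : ℕ, ¬ Converges fun n => compensated C s n ω := by
  obtain ⟨C, hC⟩ := exists_nat_ge (∑' k, |s k ω - condExpAt k (s (k + 1)) ω|)
  refine ⟨C, fun ⟨l, hl⟩ => h ?_⟩
  have heq := compensated_eq (s := s) (C := C)
    (fun n => (hsum.sum_le_tsum _ fun _ _ => abs_nonneg _).trans hC)
  have hlim := hsum.of_abs.hasSum.tendsto_sum_nat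
  refine ⟨_, ((hl.sub_const (C : ℝ)).sub hlim).congr fun n => ?_⟩
  rw [heq]
  ring

end Compensated

/-! ### Computable sequences of step functions -/

/-- `G n σ`, for a string `σ` of length at least `L n`, depends only on the first `L n` bits of `σ`
and only on those that belong to the coordinates below `n`. Everything is computable. -/
structure IsStepData (L : ℕ → ℕ) (G : ℕ → List Bool → ℕ) : Prop where
  computable_length : Computable L
  computable_value : Computable₂ G
  value_pre : ∀ n K ω, L n ≤ K → G n (pre K ω) = G n (pre (L n) ω)
  value_below : ∀ n ω, G n (pre (L n) (below n ω)) = G n (pre (L n) ω)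

/-- The step functions given by `L` and `G`, with values in the multiples of `4⁻ⁿ / 16`. -/
noncomputable def stepFun (L : ℕ → ℕ) (G : ℕ → List Bool → ℕ) (n : ℕ) (ω : CantorSeq) : ℝ :=
  G n (pre (L n) ω) / 2 ^ (2 * n + 4)

/-- The numerator of the conditional expectation of `stepFun L G (n + 1)`. -/
def condSum (L : ℕ → ℕ) (G : ℕ → List Bool → ℕ) (n : ℕ) (σ : List Bool) : ℕ :=
  stringSum (L (n + 1)) fun τ => G (n + 1) (mix n σ τ)

/-- The binary logarithm of the denominator of the conditional expectation of
`stepFun L G (n + 1)`. -/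
def condExponent (L : ℕ → ℕ) (n : ℕ) : ℕ := 2 * n + 6 + L (n + 1)

/-- One step in the computation of the martingale `compensated C (stepFun L G)`; the pair `(a, p)`
stands for `a / 2 ^ p`. -/
def compensatedStep (L : ℕ → ℕ) (G : ℕ → List Bool → ℕ) (σ : List Bool) (n : ℕ) (q : ℕ × ℕ) :
    ℕ × ℕ :=
  bif decide (condSum L G n σ * 2 ^ q.2 ≤ q.1 * 2 ^ condExponent L n) then
    (q.1 * 2 ^ condExponent L n - condSum L G n σ * 2 ^ q.2 +
      G (n + 1) σ * 2 ^ (q.2 + L (n + 1)), q.2 + condExponent L n)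
  else q

/-- The value of the martingale `compensated C (stepFun L G)`, computed from a string. -/
def compensatedValue (L : ℕ → ℕ) (G : ℕ → List Bool → ℕ) (C : ℕ) (σ : List Bool) (n : ℕ) : ℕ × ℕ :=
  Nat.rec (C * 2 ^ 4 + G 0 σ, 4) (compensatedStep L G σ) n

/-- The number of bits that `compensatedValue` needs. -/
def compensatedLength (L : ℕ → ℕ) (n : ℕ) : ℕ := ∑ k ∈ Finset.range (n + 1), L k

/-- A machine for the martingale `compensated C (stepFun L G)`. -/
def compensatedMachine (L : ℕ → ℕ) (G : ℕ → List Bool → ℕ) (C : ℕ) (n _m : ℕ) (σ : List Bool) :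
    Option ℕ :=
  bif decide (compensatedLength L n ≤ σ.length) then
    some (dyadicCode (compensatedValue L G C σ n).1 (compensatedValue L G C σ n).2)
  else none

section

variable {L : ℕ → ℕ} {G : ℕ → List Bool → ℕ}

theorem stepFun_nonneg (n : ℕ) (ω : CantorSeq) : 0 ≤ stepFun L G n ω := by
  unfold stepFun; positivity

theorem measurable_stepFun (n : ℕ) : Measurable (stepFun L G n) :=
  measurable_pre_comp (fun σ => (G n σ : ℝ) / 2 ^ (2 * n + 4)) (L n)

theorem integrable_stepFun (n : ℕ) : Integrable (stepFun L G n) unif :=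
  integrable_pre (L n) fun σ => (G n σ : ℝ) / 2 ^ (2 * n + 4)

theorem integral_stepFun (n : ℕ) : ∫ ω, stepFun L G n ω ∂unif =
    stringSum (L n) (G n) / 2 ^ L n / 2 ^ (2 * n + 4) := by
  unfold stepFun
  rw [integral_div, integral_pre_nat]

theorem stepFun_le (n : ℕ) (ω : CantorSeq) : stepFun L G n ω ≤ stringSum (L n) (G n) := by
  have h1 : G n (pre (L n) ω) ≤ stringSum (L n) (G n) :=
    List.single_le_sum (fun _ _ => Nat.zero_le _) _
      (List.mem_map.2 ⟨_, mem_strings.2 (length_pre _ _), rfl⟩)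
  refine (div_le_self (Nat.cast_nonneg _) (one_le_pow₀ one_le_two)).trans ?_
  exact_mod_cast h1

/-- The exponent `condExponent L n` collects `L (n + 1)` from averaging over strings and `2 * (n +
1) + 4` from the precision of the step function. -/
theorem condExpAt_stepFun {n K : ℕ} (hK : L (n + 1) ≤ K) (ω : CantorSeq) :
    condExpAt n (stepFun L G (n + 1)) ω = condSum L G n (pre K ω) / 2 ^ condExponent L n := by
  have h := condExpAt_pre (n := n) hK (fun σ => (G (n + 1) σ : ℝ)) ω
  have h2 : condExpAt n (stepFun L G (n + 1)) ω =
      condExpAt n (fun ω' => (G (n + 1) (pre (L (n + 1)) ω') : ℝ)) ω / 2 ^ (2 * n + 6) := by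
    unfold condExpAt stepFun
    rw [integral_div]
    rfl
  have h3 : (2 : ℝ) ^ condExponent L n = 2 ^ L (n + 1) * 2 ^ (2 * n + 6) := by
    rw [condExponent, pow_add, mul_comm]
  rw [h2, h, condSum, stringSum, Nat.cast_list_sum, List.map_map, h3, div_div]
  rfl

theorem IsStepData.compensatedValue_spec (h : IsStepData L G) (C : ℕ) {K : ℕ} (ω : CantorSeq)
    (n : ℕ) (hK : ∀ k ≤ n, L k ≤ K) :
    ((compensatedValue L G C (pre K ω) n).1 : ℝ) / 2 ^ (compensatedValue L G C (pre K ω) n).2 =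
      compensated C (stepFun L G) n ω := by
  induction n with
  | zero =>
    change ((C * 2 ^ 4 + G 0 (pre K ω) : ℕ) : ℝ) / 2 ^ 4 = C + G 0 (pre (L 0) ω) / 2 ^ 4
    rw [h.value_pre 0 K ω (hK 0 le_rfl)]
    push_cast
    ring
  | succ n ih =>
    have ih := ih fun k hk => hK k (by omega)
    set q := compensatedValue L G C (pre K ω) n with hq
    have hstep : compensatedValue L G C (pre K ω) (n + 1) =
      compensatedStep L G (pre K ω) n q := rfl
    have hE := condExpAt_stepFun (G := G) (hK (n + 1) le_rfl) ω
    have hs : stepFun L G (n + 1) ω = G (n + 1) (pre K ω) / 2 ^ (2 * n + 6) := by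
      rw [stepFun, h.value_pre _ K ω (hK _ le_rfl)]
      rfl
    -- Comparing dyadic numbers by cross-multiplication is exact, so the machine decides the
    -- skipping test without error; a passed test also makes the truncated subtraction a true one.
    have hiff : condSum L G n (pre K ω) * 2 ^ q.2 ≤ q.1 * 2 ^ condExponent L n ↔
        condExpAt n (stepFun L G (n + 1)) ω ≤ compensated C (stepFun L G) n ω := by
      rw [hE, ← ih, div_le_div_iff₀ (by positivity) (by positivity)]
      exact_mod_cast Iff.rfl
    rw [hstep, compensatedStep, compensated]
    by_cases hc : condSum L G n (pre K ω) * 2 ^ q.2 ≤ q.1 * 2 ^ condExponent L n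
    · rw [if_pos (hiff.1 hc), decide_eq_true hc, cond_true, hE, hs, ← ih]
      dsimp only
      rw [Nat.cast_add, Nat.cast_sub hc]
      push_cast
      rw [condExponent]
      simp only [pow_add]
      field_simp
    · rw [if_neg (mt hiff.2 hc), decide_eq_false hc, cond_false, ih]

theorem IsStepData.stepFun_below (h : IsStepData L G) (n : ℕ) (ω : CantorSeq) :
    stepFun L G n (below n ω) = stepFun L G n ω := by
  rw [stepFun, stepFun, h.value_below]

theorem computable_compensatedLength (hL : Computable L) : Computable (compensatedLength L) :=
  computable_sum_range (g := fun _ k => L k) Computable.succ (hL.comp .snd)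

theorem IsStepData.computable_condSum (h : IsStepData L G) : Computable₂ (condSum L G) := by
  refine computable_stringSum (g := fun (p : ℕ × List Bool) τ => G (p.1 + 1) (mix p.1 p.2 τ))
    (h.computable_length.comp (Computable.succ.comp .fst)) ?_
  exact h.computable_value.comp (Computable.succ.comp (Computable.fst.comp .fst))
    (computable_mix (Computable.fst.comp .fst) (Computable.snd.comp .fst) .snd)

theorem IsStepData.computable_condExponent (h : IsStepData L G) : Computable (condExponent L) :=
  computable_add (computable_add (computable_mul (.const 2) .id) (.const 6))
    (h.computable_length.comp .succ)

theorem IsStepData.computable_compensatedValue (h : IsStepData L G) (C : ℕ) :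
    Computable₂ fun (n : ℕ) (σ : List Bool) => compensatedValue L G C σ n := by
  have hn : Computable fun p : (ℕ × List Bool) × ℕ × (ℕ × ℕ) => p.2.1 :=
    Computable.fst.comp .snd
  have hσ : Computable fun p : (ℕ × List Bool) × ℕ × (ℕ × ℕ) => p.1.2 := Computable.snd.comp .fst
  have hq : Computable fun p : (ℕ × List Bool) × ℕ × (ℕ × ℕ) => p.2.2 := Computable.snd.comp .snd
  have hq1 := Computable.fst.comp hq
  have hq2 := Computable.snd.comp hq
  have hE := h.computable_condExponent.comp hn
  have h1 := computable_mul (h.computable_condSum.comp hn hσ) (computable_pow (.const 2) hq2)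
  have h2 := computable_mul hq1 (computable_pow (.const 2) hE)
  have h3 := computable_mul (h.computable_value.comp (Computable.succ.comp hn) hσ)
    (computable_pow (.const 2) (computable_add hq2
      (h.computable_length.comp (Computable.succ.comp hn))))
  have hstep : Computable₂ fun (p : ℕ × List Bool) (r : ℕ × (ℕ × ℕ)) =>
      compensatedStep L G p.2 r.1 r.2 :=
    Computable.cond (computable_le h1 h2)
      ((computable_add (computable_sub h2 h1) h3).pair (computable_add hq2 hE)) hq
  have hinit : Computable fun p : ℕ × List Bool => (C * 2 ^ 4 + G 0 p.2, 4) :=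
    (computable_add (.const _) (h.computable_value.comp (.const 0) .snd)).pair (.const 4)
  exact Computable.nat_rec Computable.fst hinit hstep

theorem IsStepData.isMachine (h : IsStepData L G) (C : ℕ) :
    IsMachine (compensatedMachine L G C) := by
  have hσ : Computable fun p : ℕ × ℕ × List Bool => p.2.2 := Computable.snd.comp .snd
  have hv : Computable fun p : ℕ × ℕ × List Bool => compensatedValue L G C p.2.2 p.1 :=
    (h.computable_compensatedValue C).comp .fst hσ
  exact Computable.cond (computable_le
    ((computable_compensatedLength h.computable_length).comp .fst)
    (Computable.list_length.comp hσ))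
    (Computable.option_some.comp
      (computable_dyadicCode (Computable.fst.comp hv) (Computable.snd.comp hv))) (.const none)

/-- The machine waits for `compensatedLength L n` bits, enough for every step up to `n`. The value
is then known exactly, so the constant sequence of its code is a name. -/
theorem IsStepData.isComputableMartingale (h : IsStepData L G) (C : ℕ) :
    IsComputableMartingale (compensated C (stepFun L G)) := by
  refine ⟨isMartingale_compensated (Nat.cast_nonneg C) stepFun_nonneg measurable_stepFun
    h.stepFun_below stepFun_le, compensatedMachine L G C, h.isMachine C, fun n ω => ?_⟩
  set σ := pre (compensatedLength L n) (below n ω) with hσ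
  refine ⟨fun _ => dyadicCode (compensatedValue L G C σ n).1 (compensatedValue L G C σ n).2,
    fun m => ⟨compensatedLength L n, ?_, fun t ht => ?_⟩, ?_⟩
  · change compensatedMachine L G C n m σ = _
    rw [compensatedMachine, hσ, length_pre, decide_eq_true le_rfl, cond_true]
  · rw [compensatedMachine, bitPrefix_length, decide_eq_false (not_le.2 ht), cond_false]
  · have hv := h.compensatedValue_spec C (K := compensatedLength L n) (below n ω) n fun k hk =>
      Finset.single_le_sum (f := L) (fun _ _ => Nat.zero_le _)
        (Finset.mem_range.2 (Nat.lt_succ_of_le hk))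
    rw [compensated_below h.stepFun_below le_rfl] at hv
    rw [← hv]
    exact isCauchyName_dyadicCode _ _

theorem IsStepData.exists_bound (h : IsStepData L G) (C : ℕ) :
    ∃ d : ℕ → ℝ, IsComputableRealSeq d ∧ ∀ n ω, |compensated C (stepFun L G) n ω| ≤ d n := by
  -- The factor `2 ^ 0` only puts the natural number into the form that `dyadicCode` names.
  refine ⟨fun n => ((C + ∑ k ∈ Finset.range (n + 1), stringSum (L k) (G k) : ℕ) : ℝ) / 2 ^ 0,
    ⟨fun n _ => dyadicCode (C + ∑ k ∈ Finset.range (n + 1), stringSum (L k) (G k)) 0, ?_,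
      fun n => isCauchyName_dyadicCode _ _⟩, fun n ω => ?_⟩
  · refine computable_dyadicCode (computable_add (.const C) ?_) (.const 0)
    refine computable_sum_range (g := fun _ k => stringSum (L k) (G k))
      (Computable.succ.comp .fst) ?_
    exact computable_stringSum (g := fun (p : (ℕ × ℕ) × ℕ) σ => G p.2 σ)
      (h.computable_length.comp .snd) (h.computable_value.comp (Computable.snd.comp .fst) .snd)
  · rw [abs_of_nonneg (compensated_nonneg (Nat.cast_nonneg C) stepFun_nonneg n ω)]
    simpa using compensated_le (C := C) stepFun_nonneg stepFun_le n ω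

end

/-! ### Approximation of an a.e. computable martingale by step functions -/

/-- A lower approximation to `2 ^ m * (r + 1)` obtained from the `m`-th entry `v` of a name of the
nonnegative real number `r`. -/
def lowerApprox (m v : ℕ) : ℕ :=
  2 ^ m * (v.unpair.1.unpair.1 - v.unpair.1.unpair.2) / (v.unpair.2 + 1) - 1 + 2 ^ m

theorem computable_lowerApprox : Computable₂ lowerApprox := by
  have hu : Computable fun p : ℕ × ℕ => p.2.unpair := Computable.unpair.comp .snd
  have hu1 := Computable.unpair.comp (Computable.fst.comp hu)
  have hp : Computable fun p : ℕ × ℕ => 2 ^ p.1 := computable_pow (.const 2) .fst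
  exact computable_add (computable_sub (computable_div (computable_mul hp
    (computable_sub (Computable.fst.comp hu1) (Computable.snd.comp hu1)))
    (computable_add (Computable.snd.comp hu) (.const 1))) (.const 1)) hp

theorem lowerApprox_pos (m v : ℕ) : 0 < lowerApprox m v :=
  Nat.add_pos_right _ (by positivity)

/-- After scaling by `2 ^ m`, the name errs by at most 1, rounding down loses less than 1, and 1 is
subtracted to stay below: 3 in total. Truncating negative values at 0 is harmless because `0 ≤ r`.
-/
theorem lowerApprox_spec {x : ℕ → ℕ} {r : ℝ} (hx : IsCauchyName x r) (hr : 0 ≤ r) (m : ℕ) :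
    (lowerApprox m (x m) : ℝ) ≤ 2 ^ m * (r + 1) ∧
      2 ^ m * (r + 1) ≤ lowerApprox m (x m) + 3 := by
  have h := hx.abs_le m
  rw [one_div, inv_pow, ← one_div, le_div_iff₀ (by positivity), ← abs_of_pos (a := (2 : ℝ) ^ m)
    (by positivity), ← abs_mul, abs_le] at h
  have h0 : (0 : ℝ) ≤ 2 ^ m * r := by positivity
  rw [lowerApprox, ratPoint] at *
  generalize (x m).unpair.1.unpair.1 = a at *
  generalize (x m).unpair.1.unpair.2 = b at *
  generalize (x m).unpair.2 = c at *
  push_cast at h ⊢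
  have hc : (0 : ℝ) < c + 1 := by positivity
  set t : ℝ := (a - b) / (c + 1) with ht
  rcases le_total b a with hab | hab
  · set q := 2 ^ m * (a - b) / (c + 1) with hq
    have e : ((2 ^ m * (a - b) : ℕ) : ℝ) = 2 ^ m * t * (c + 1) := by
      rw [ht]; push_cast [Nat.cast_sub hab]; field_simp
    have h1 : (q : ℝ) ≤ 2 ^ m * t := by
      have : ((q * (c + 1) : ℕ) : ℝ) ≤ ((2 ^ m * (a - b) : ℕ) : ℝ) :=
        Nat.cast_le.2 (Nat.div_mul_le_self _ _)
      rw [e] at this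
      push_cast at this
      exact le_of_mul_le_mul_right this hc
    have h2 : 2 ^ m * t < q + 1 := by
      have : ((2 ^ m * (a - b) : ℕ) : ℝ) < (((q + 1) * (c + 1) : ℕ) : ℝ) := by
        refine Nat.cast_lt.2 ?_
        rw [mul_comm (q + 1)]
        exact Nat.lt_mul_div_succ _ (Nat.succ_pos _)
      rw [e] at this
      push_cast at this
      exact lt_of_mul_lt_mul_right this hc.le
    rcases Nat.eq_zero_or_pos q with h3 | h3
    · rw [h3] at h2 ⊢
      simp only [Nat.zero_sub, Nat.cast_zero] at h2 ⊢
      constructor <;> nlinarith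
    · rw [Nat.cast_sub h3]
      push_cast
      constructor <;> nlinarith
  · rw [Nat.sub_eq_zero_of_le hab]
    have ht' : t ≤ 0 :=
      div_nonpos_of_nonpos_of_nonneg (sub_nonpos.2 (Nat.cast_le.2 hab)) hc.le
    have : (2 : ℝ) ^ m * t ≤ 0 := mul_nonpos_of_nonneg_of_nonpos (by positivity) ht'
    simp only [mul_zero, Nat.zero_div, Nat.zero_sub, Nat.cast_zero]
    constructor <;> nlinarith

/-- The lower approximation to `2 ^ m * (Mₙ(ω) + 1)` that the machine `φ` gives from an initial
segment of `⨁ₙ ωₙ`, zero if the initial segment is too short. -/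
def stageApprox (φ : ℕ → ℕ → List Bool → Option ℕ) (n m : ℕ) (σ : List Bool) : ℕ :=
  (runBelow φ n m σ).elim 0 (lowerApprox m)

section

variable {φ : ℕ → ℕ → List Bool → Option ℕ}

theorem computable_stageApprox (hφ : IsMachine φ) :
    Computable fun p : ℕ × ℕ × List Bool => stageApprox φ p.1 p.2.1 p.2.2 := by
  refine (Computable.option_casesOn (g := fun (p : ℕ × ℕ × List Bool) v => lowerApprox p.2.1 v)
    (computable_runBelow hφ) (.const 0) (computable_lowerApprox.comp
      (Computable.fst.comp (Computable.snd.comp .fst)) .snd)).of_eq fun p => ?_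
  unfold stageApprox
  cases runBelow φ p.1 p.2.1 p.2.2 <;> rfl

theorem IsMachine.computable_stageApprox_comp (hφ : IsMachine φ) {α : Type*} [Primcodable α]
    {f g : α → ℕ} {h : α → List Bool} (hf : Computable f) (hg : Computable g) (hh : Computable h) :
    Computable fun a => stageApprox φ (f a) (g a) (h a) :=
  (computable_stageApprox hφ).comp (hf.pair (hg.pair hh))

variable {n : ℕ} {ω : CantorSeq} {x : ℕ → ℕ} {r : ℝ}

theorem stageApprox_eq (hx : Produces φ n (interleave (below n ω)) x) (m K : ℕ)
    (h : stageApprox φ n m (pre K ω) ≠ 0) :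
    stageApprox φ n m (pre K ω) = lowerApprox m (x m) := by
  unfold stageApprox at *
  rcases hr : runBelow φ n m (pre K ω) with _ | v
  · rw [hr] at h; exact absurd rfl h
  · rw [(haltsWith_of_runBelow hr).unique (hx m)]; rfl

theorem stageApprox_le (hx : Produces φ n (interleave (below n ω)) x) (hr : IsCauchyName x r)
    (h0 : 0 ≤ r) (m K : ℕ) : (stageApprox φ n m (pre K ω) : ℝ) ≤ 2 ^ m * (r + 1) := by
  by_cases h : stageApprox φ n m (pre K ω) = 0
  · rw [h, Nat.cast_zero]; positivity
  · rw [stageApprox_eq hx m K h]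
    exact (lowerApprox_spec hr h0 m).1

theorem le_stageApprox (hx : Produces φ n (interleave (below n ω)) x) (hr : IsCauchyName x r)
    (h0 : 0 ≤ r) (m K : ℕ) (h : stageApprox φ n m (pre K ω) ≠ 0) :
    2 ^ m * (r + 1) ≤ stageApprox φ n m (pre K ω) + 3 := by
  rw [stageApprox_eq hx m K h]
  exact (lowerApprox_spec hr h0 m).2

theorem eventually_stageApprox_ne_zero (hx : Produces φ n (interleave (below n ω)) x) (m : ℕ) :
    ∀ᶠ K in atTop, stageApprox φ n m (pre K ω) ≠ 0 := by
  obtain ⟨K₀, hK⟩ := (hx m).exists_runBelow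
  filter_upwards [eventually_ge_atTop K₀] with K h
  rw [stageApprox, hK K h]
  exact (lowerApprox_pos m _).ne'

end

/-- `φ` computes `M` almost everywhere. -/
structure ComputesAE (φ : ℕ → ℕ → List Bool → Option ℕ) (M : ℕ → CantorSeq → ℝ) : Prop where
  isMachine : IsMachine φ
  ae_produces : ∀ n, ∀ᵐ ω ∂unif, ∃ x, Produces φ n (interleave (below n ω)) x
  isCauchyName : ∀ n ω x, Produces φ n (interleave (below n ω)) x → IsCauchyName x (M n ω)

section

variable {φ : ℕ → ℕ → List Bool → Option ℕ} {M : ℕ → CantorSeq → ℝ}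

/-- The oracle `below 0 ω` is the same for all `ω`, so a single point of the domain settles every
point. -/
theorem ComputesAE.exists_produces_zero (hφ : ComputesAE φ M) :
    ∃ x, (∀ ω, Produces φ 0 (interleave (below 0 ω)) x) ∧
      ∀ ω, IsCauchyName x (M 0 ω) := by
  obtain ⟨ω₀, x, hx⟩ := (hφ.ae_produces 0).exists
  have h : ∀ ω, below 0 ω = below 0 ω₀ := fun ω => by funext i; simp [below]
  exact ⟨x, fun ω => by rwa [h], fun ω => hφ.isCauchyName 0 ω x (by rwa [h])⟩

theorem IsMartingale.integral_eq (hM : IsMartingale M) {a : ℝ} (ha : ∀ ω, M 0 ω = a) (n : ℕ) :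
    ∫ ω, M n ω ∂unif = a := by
  obtain ⟨ω, hω⟩ := (hM.condExp 0 n (Nat.zero_le n)).exists
  rw [← ha ω, ← hω]
  rfl

/-- This supplies a computable target against which the integrals of the approximations are
measured. -/
theorem ComputesAE.exists_initial (hφ : ComputesAE φ M) (h0 : ∀ n ξ, 0 ≤ M n ξ) {a : ℝ}
    (ha : ∀ ω, M 0 ω = a) : ∃ k : ℕ → ℕ, Computable k ∧
      ∀ m, (k m : ℝ) ≤ 2 ^ m * (a + 1) ∧ 2 ^ m * (a + 1) ≤ k m + 3 := by
  obtain ⟨x, hx, hr⟩ := hφ.exists_produces_zero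
  let ω : CantorSeq := fun _ _ => false
  let z : ℕ → List Bool := fun K => (List.range K).map fun _ => false
  have hz : ∀ K, z K = pre K ω := fun K => rfl
  have hzc : Computable z :=
    (Primrec.list_map Primrec.list_range ((Primrec.const false).to₂)).to_comp
  have hP : Computable₂ fun m K => decide (0 < stageApprox φ 0 m (z K)) := by
    refine computable_lt (.const 0) ?_
    exact hφ.isMachine.computable_stageApprox_comp (.const 0) .fst (hzc.comp .snd)
  obtain ⟨f, hf, hfs⟩ := exists_computable_choice hP fun m => by
    obtain ⟨K, hK⟩ := (eventually_stageApprox_ne_zero (hx ω) m).exists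
    exact ⟨K, decide_eq_true (Nat.pos_of_ne_zero hK)⟩
  refine ⟨fun m => stageApprox φ 0 m (z (f m)),
    hφ.isMachine.computable_stageApprox_comp (.const 0) .id (hzc.comp hf), fun m => ?_⟩
  have h1 := hr ω
  have h2 := h0 0 ω
  rw [ha] at h1 h2
  have h3 := hfs m
  rw [decide_eq_true_eq] at h3
  exact ⟨stageApprox_le (hx ω) h1 h2 m _, le_stageApprox (hx ω) h1 h2 m _ h3.ne'⟩

/-- Almost every oracle eventually makes the machine halt, and then the approximation plus 3 is at
least `2 ^ m * (M n ω + 1)`. Capping by that integrable function gives dominated convergence. The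
constant 4 is this 3 plus a loss of 1 for stopping at a finite `L`. -/
theorem ComputesAE.exists_stage (hφ : ComputesAE φ M) (hM : IsMartingale M)
    (h0 : ∀ n ξ, 0 ≤ M n ξ) {a : ℝ} (ha : ∀ ω, M 0 ω = a) (n m : ℕ) :
    ∃ L, 2 ^ m * (a + 1) ≤ (stringSum L (stageApprox φ n m) : ℝ) / 2 ^ L + 4 := by
  have hF : Integrable (fun ω => 2 ^ m * (M n ω + 1)) unif :=
    ((hM.integrable n).add (integrable_const 1)).const_mul _
  have hint : ∫ ω, 2 ^ m * (M n ω + 1) ∂unif = 2 ^ m * (a + 1) := by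
    rw [integral_const_mul, integral_add (hM.integrable n) (integrable_const 1),
      hM.integral_eq ha n]
    simp
  have hpos : ∀ ω, 0 ≤ 2 ^ m * (M n ω + 1) := fun ω => by
    have := h0 n ω; positivity
  have hmeas : ∀ L, Measurable fun ω => (stageApprox φ n m (pre L ω) : ℝ) + 3 := fun L =>
    measurable_pre_comp (fun σ => (stageApprox φ n m σ : ℝ) + 3) L
  have hlim := tendsto_integral_of_dominated_convergence (μ := unif)
    (F := fun L ω => min ((stageApprox φ n m (pre L ω) : ℝ) + 3) (2 ^ m * (M n ω + 1)))
    (f := fun ω => 2 ^ m * (M n ω + 1)) (fun ω => 2 ^ m * (M n ω + 1))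
    (fun L => (hmeas L).aestronglyMeasurable.inf hF.1) hF
    (fun L => .of_forall fun ω => by
      rw [Real.norm_of_nonneg (le_min (by positivity) (hpos ω))]
      exact min_le_right _ _)
    (by
      filter_upwards [hφ.ae_produces n] with ω ⟨x, hx⟩
      refine tendsto_const_nhds.congr' ?_
      filter_upwards [eventually_stageApprox_ne_zero hx m] with L hL
      exact (min_eq_right (le_stageApprox hx (hφ.isCauchyName n ω x hx) (h0 n ω) m L hL)).symm)
  rw [hint] at hlim
  obtain ⟨L, hL⟩ := (hlim.eventually (lt_mem_nhds (sub_one_lt (2 ^ m * (a + 1))))).exists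
  refine ⟨L, ?_⟩
  have hi := integrable_pre L (fun σ => (stageApprox φ n m σ : ℝ) + 3)
  have h1 : ∫ ω, min ((stageApprox φ n m (pre L ω) : ℝ) + 3) (2 ^ m * (M n ω + 1)) ∂unif ≤
      ∫ ω, ((stageApprox φ n m (pre L ω) : ℝ) + 3) ∂unif :=
    integral_mono (hi.inf hF) hi fun ω => min_le_left _ _
  rw [integral_add (integrable_pre L (fun σ => (stageApprox φ n m σ : ℝ))) (integrable_const 3),
    integral_pre_nat] at h1
  simp only [integral_const, probReal_univ, smul_eq_mul, one_mul] at h1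
  linarith

/-- The step functions given by `L` and `G` approximate `M + 1` from below. -/
structure Approximates (φ : ℕ → ℕ → List Bool → Option ℕ) (M : ℕ → CantorSeq → ℝ) (L : ℕ → ℕ)
    (G : ℕ → List Bool → ℕ) : Prop where
  isStepData : IsStepData L G
  ae_le : ∀ n, ∀ᵐ ω ∂unif, stepFun L G n ω ≤ M n ω + 1
  integral_le : ∀ n, ∫ ω, (M n ω + 1) ∂unif - ∫ ω, stepFun L G n ω ∂unif ≤ 7 / 2 ^ (2 * n + 4)
  dist_le : ∀ n ω x, Produces φ n (interleave (below n ω)) x → stepFun L G n ω ≠ 0 →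
    |M n ω + 1 - stepFun L G n ω| ≤ 3 / 2 ^ (2 * n + 4)

theorem ComputesAE.exists_approximates (hφ : ComputesAE φ M) (hM : IsMartingale M)
    (h0 : ∀ n ξ, 0 ≤ M n ξ) : ∃ L G, Approximates φ M L G := by
  obtain ⟨a, ha⟩ : ∃ a, ∀ ω, M 0 ω = a := by
    obtain ⟨x, -, hx⟩ := hφ.exists_produces_zero
    exact ⟨M 0 fun _ _ => false, fun ω => (hx ω).unique (hx _)⟩
  obtain ⟨k, hk, hka⟩ := hφ.exists_initial h0 ha
  have hm : ∀ {α : Type} [Primcodable α] {f : α → ℕ}, Computable f →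
      Computable fun a => 2 * f a + 4 := fun hf =>
    computable_add (computable_mul (.const 2) hf) (.const 4)
  have hsum : Computable fun p : ℕ × ℕ => stringSum p.2 (stageApprox φ p.1 (2 * p.1 + 4)) :=
    computable_stringSum (g := fun (p : ℕ × ℕ) σ => stageApprox φ p.1 (2 * p.1 + 4) σ) .snd
      (hφ.isMachine.computable_stageApprox_comp (Computable.fst.comp .fst)
        (hm (Computable.fst.comp .fst)) .snd)
  have hpow : Computable fun p : ℕ × ℕ => 2 ^ p.2 := computable_pow (.const 2) .snd
  -- The search condition replaces the real target by its integer lower approximation `k`. That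
  -- costs 3 beyond the tolerance 4, whence the 7 in `Approximates`.
  have hP : Computable₂ fun n L => decide (k (2 * n + 4) * 2 ^ L ≤
      stringSum L (stageApprox φ n (2 * n + 4)) + 4 * 2 ^ L) :=
    computable_le (computable_mul (hk.comp (hm .fst)) hpow)
      (computable_add hsum (computable_mul (.const 4) hpow))
  obtain ⟨L, hL, hLs⟩ := exists_computable_choice hP fun n => by
    obtain ⟨L, hL⟩ := hφ.exists_stage hM h0 ha n (2 * n + 4)
    refine ⟨L, decide_eq_true ?_⟩
    have h1 := (hka (2 * n + 4)).1.trans hL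
    have h2 : (0 : ℝ) < 2 ^ L := by positivity
    rw [div_add' _ _ _ h2.ne', le_div_iff₀ h2] at h1
    exact_mod_cast h1
  -- Truncating to `L n` bits makes the value independent of any further bits supplied.
  let G : ℕ → List Bool → ℕ := fun n σ => stageApprox φ n (2 * n + 4) (σ.take (L n))
  have hGpre : ∀ n K ω, L n ≤ K →
      G n (pre K ω) = stageApprox φ n (2 * n + 4) (pre (L n) ω) := by
    intro n K ω h
    simp only [G, take_pre ω h]
  have hstep : ∀ n ω, stepFun L G n ω =
      stageApprox φ n (2 * n + 4) (pre (L n) ω) / 2 ^ (2 * n + 4) := by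
    intro n ω
    rw [stepFun, hGpre n _ ω le_rfl]
  have hD : IsStepData L G := by
    refine ⟨hL, hφ.isMachine.computable_stageApprox_comp .fst (hm .fst)
      (computable_take (hL.comp .fst) .snd), fun n K ω h => ?_, fun n ω => ?_⟩
    · rw [hGpre n K ω h, hGpre n _ ω le_rfl]
    · rw [hGpre n _ _ le_rfl, hGpre n _ _ le_rfl, stageApprox, stageApprox, runBelow, runBelow,
        mask_pre, mask_pre, below_below le_rfl]
  refine ⟨L, G, hD, fun n => ?_, fun n => ?_, fun n ω x hx h => ?_⟩
  · filter_upwards [hφ.ae_produces n] with ω ⟨x, hx⟩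
    rw [hstep, div_le_iff₀' (by positivity)]
    exact stageApprox_le hx (hφ.isCauchyName n ω x hx) (h0 n ω) _ _
  · have hs : stringSum (L n) (G n) = stringSum (L n) (stageApprox φ n (2 * n + 4)) := by
      unfold stringSum
      congr 1
      refine List.map_congr_left fun σ hσ => ?_
      rw [mem_strings] at hσ
      simp only [G, ← hσ, List.take_length]
    rw [integral_stepFun, hs, integral_add (hM.integrable n) (integrable_const 1),
      hM.integral_eq ha n]
    simp only [integral_const, probReal_univ, smul_eq_mul, one_mul]
    have h1 := hLs n
    rw [decide_eq_true_eq] at h1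
    have h2 : ((k (2 * n + 4) * 2 ^ L n : ℕ) : ℝ) ≤
      ((stringSum (L n) (stageApprox φ n (2 * n + 4)) + 4 * 2 ^ L n : ℕ) : ℝ) := Nat.cast_le.2 h1
    push_cast at h2
    have h3 : (0 : ℝ) < 2 ^ L n := by positivity
    rw [← le_div_iff₀ h3, add_div, mul_div_cancel_right₀ _ h3.ne'] at h2
    have h4 := (hka (2 * n + 4)).2
    have h5 : (0 : ℝ) < 2 ^ (2 * n + 4) := by positivity
    rw [sub_le_iff_le_add, ← add_div, le_div_iff₀ h5]
    linarith
  · have h5 : (0 : ℝ) < 2 ^ (2 * n + 4) := by positivity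
    have hne : stageApprox φ n (2 * n + 4) (pre (L n) ω) ≠ 0 := by
      intro hz
      rw [hstep, hz] at h
      simp at h
    have hr := hφ.isCauchyName n ω x hx
    have h1 := stageApprox_le hx hr (h0 n ω) (2 * n + 4) (L n)
    have h2 := le_stageApprox hx hr (h0 n ω) (2 * n + 4) (L n) hne
    rw [hstep, abs_le, le_sub_iff_add_le, sub_le_iff_le_add, ← neg_div, ← add_div, ← add_div,
      div_le_iff₀ h5, le_div_iff₀ h5]
    constructor <;> linarith

end

/-! ### Schnorr random points -/

/-- Markov's inequality, in the form of the hypothesis of `IsSchnorrRandom.eventually_not`. -/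
theorem stringCount_le_of_integral_le {K k : ℕ} {P : List Bool → Bool} {f : CantorSeq → ℝ}
    (hf : Integrable f unif) (h0 : ∀ᵐ ω ∂unif, 0 ≤ f ω) {ε : ℝ} (hε : 0 < ε)
    (h : ∀ᵐ ω ∂unif, P (pre K ω) = true → ε ≤ f ω) (hi : ∫ ω, f ω ∂unif ≤ ε * (1 / 2) ^ k) :
    (stringCount K P : ℝ) / 2 ^ K ≤ (1 / 2) ^ k := by
  rw [← unif_pre]
  have h1 := mul_meas_ge_le_integral_of_nonneg h0 hf ε
  have h2 : unif.real {ω | P (pre K ω) = true} ≤ unif.real {ω | ε ≤ f ω} :=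
    ENNReal.toReal_mono (measure_ne_top _ _) (measure_mono_ae h)
  exact le_of_mul_le_mul_left ((mul_le_mul_of_nonneg_left h2 hε.le).trans (h1.trans hi)) hε

/-- For fixed `n` and `m`, the oracles on which the procedure is still unfinished after `K` bits
have measure tending to 0. Lengths with measure at most `2⁻ᵏ` can be searched for, and
Borel–Cantelli then forces halting at `ω`. -/
theorem ComputesAE.exists_produces {φ : ℕ → ℕ → List Bool → Option ℕ}
    {M : ℕ → CantorSeq → ℝ} (hφ : ComputesAE φ M) {ω : CantorSeq} (hω : IsSchnorrRandom ω) (n : ℕ) :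
    ∃ x, Produces φ n (interleave (below n ω)) x := by
  suffices h : ∀ m, ∃ v, HaltsWith (φ n m) (interleave (below n ω)) v by
    choose x hx using h
    exact ⟨x, hx⟩
  intro m
  let P : List Bool → Bool := fun σ => decide (stageApprox φ n m σ ≤ 0)
  have hP : Computable P :=
    computable_le (hφ.isMachine.computable_stageApprox_comp (.const n) (.const m) .id) (.const 0)
  have hlim : Tendsto (fun K => (stringCount K P : ℝ) / 2 ^ K) atTop (𝓝 0) := by
    have h1 : ∀ K, (stringCount K P : ℝ) / 2 ^ K = ∫ ω, ((P (pre K ω)).toNat : ℝ) ∂unif :=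
      fun K => (integral_pre_nat K fun σ => (P σ).toNat).symm
    simp_rw [h1]
    rw [← integral_zero CantorSeq ℝ (μ := unif)]
    refine tendsto_integral_of_dominated_convergence (fun _ => 1)
      (fun K => (measurable_pre_comp (fun σ => ((P σ).toNat : ℝ)) K).aestronglyMeasurable)
      (integrable_const 1) (fun K => .of_forall fun ω => ?_) ?_
    · cases P (pre K ω) <;> simp
    · filter_upwards [hφ.ae_produces n] with ω ⟨x, hx⟩
      refine tendsto_const_nhds.congr' ?_
      filter_upwards [eventually_stageApprox_ne_zero hx m] with K hK
      simp [P, hK]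
  have hQ : Computable₂ fun k K => decide (stringCount K P * 2 ^ k ≤ 2 ^ K) := by
    refine computable_le (computable_mul ?_ (computable_pow (.const 2) .fst))
      (computable_pow (.const 2) .snd)
    exact computable_stringCount (P := fun (_ : ℕ × ℕ) σ => P σ) .snd (hP.comp .snd)
  have hiff : ∀ k K, stringCount K P * 2 ^ k ≤ 2 ^ K ↔
      (stringCount K P : ℝ) / 2 ^ K ≤ (1 / 2) ^ k := by
    intro k K
    rw [one_div, inv_pow, ← one_div, div_le_div_iff₀ (by positivity) (by positivity), one_mul]
    exact_mod_cast Iff.rfl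
  obtain ⟨L, hL, hLs⟩ := exists_computable_choice hQ fun k => by
    obtain ⟨K, hK⟩ := (hlim.eventually (gt_mem_nhds (by positivity : (0 : ℝ) < (1 / 2) ^ k))).exists
    exact ⟨K, decide_eq_true ((hiff k K).2 hK.le)⟩
  obtain ⟨k, hk⟩ := hω.eventually_not (P := fun _ => P) (hP.comp .snd) hL
    fun k => (hiff k _).1 (of_decide_eq_true (hLs k))
  have h1 := hk k le_rfl
  rcases hv : runBelow φ n m (pre (L k) ω) with _ | v
  · simp [P, stageApprox, hv] at h1
  · exact ⟨v, haltsWith_of_runBelow hv⟩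

section

variable {φ : ℕ → ℕ → List Bool → Option ℕ} {M : ℕ → CantorSeq → ℝ} {L : ℕ → ℕ}
  {G : ℕ → List Bool → ℕ} {ω : CantorSeq}

/-- Where the step function vanishes, its deficit from `M n + 1` is at least 1, so Markov's
inequality bounds the measure of this set by `7 / 2 ^ (2 * n + 4) ≤ 2⁻ⁿ`. -/
theorem Approximates.eventually_ne_zero (h : Approximates φ M L G) (hM : IsMartingale M)
    (h0 : ∀ n ξ, 0 ≤ M n ξ) (hω : IsSchnorrRandom ω) : ∀ᶠ n in atTop, stepFun L G n ω ≠ 0 := by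
  have hG := h.isStepData.computable_value
  obtain ⟨k, hk⟩ := hω.eventually_not (P := fun n σ => decide (G n σ ≤ 0))
    (computable_le hG (.const 0)) h.isStepData.computable_length fun n => by
    have hF : Integrable (fun ω => M n ω + 1) unif := (hM.integrable n).add (integrable_const 1)
    refine stringCount_le_of_integral_le (f := fun ω => M n ω + 1 - stepFun L G n ω)
      (hF.sub (integrable_stepFun n)) ((h.ae_le n).mono fun ω h => sub_nonneg.2 h) one_pos
      (.of_forall fun ω h => ?_) ?_
    · rw [decide_eq_true_eq, Nat.le_zero] at h
      have := h0 n ω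
      simp [stepFun, h, this]
    · rw [integral_sub hF (integrable_stepFun n), one_mul]
      refine (h.integral_le n).trans ?_
      have h1 : (1 : ℝ) ≤ 2 ^ n := one_le_pow₀ one_le_two
      rw [one_div, inv_pow, ← one_div, div_le_div_iff₀ (by positivity) (by positivity), pow_add,
        pow_mul', sq]
      nlinarith
  filter_upwards [eventually_ge_atTop k] with n hn
  have := hk n hn
  rw [decide_eq_false_iff_not, Nat.le_zero] at this
  rw [stepFun]
  positivity

/-- The mean of the `k`-th defect is at most `(7/16 + 7/64) * 4⁻ᵏ < 4⁻ᵏ`. Markov's inequality at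
threshold `2⁻ᵏ` leaves measure at most `2⁻ᵏ`, so eventually the defect at `ω` is bounded by a
geometric term. -/
theorem Approximates.summable (h : Approximates φ M L G) (hM : IsMartingale M)
    (hω : IsSchnorrRandom ω) :
    Summable fun k => |stepFun L G k ω - condExpAt k (stepFun L G (k + 1)) ω| := by
  have hD := h.isStepData
  -- The numerator of the step function over the common denominator `2 ^ condExponent L k`; the sum
  -- of the two truncated differences in `P` is then the absolute difference of numerators.
  let X : ℕ → List Bool → ℕ := fun k σ => G k σ * 2 ^ (2 + L (k + 1))
  let Y : ℕ → List Bool → ℕ := condSum L G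
  let P : ℕ → List Bool → Bool := fun k σ =>
    decide (2 ^ condExponent L k < 2 ^ k * ((X k σ - Y k σ) + (Y k σ - X k σ)))
  have hX : Computable₂ X := computable_mul hD.computable_value
    (computable_pow (.const 2) (computable_add (.const 2)
      (hD.computable_length.comp (Computable.succ.comp .fst))))
  have hY : Computable₂ Y := hD.computable_condSum
  have hP : Computable₂ P := by
    refine computable_lt (computable_pow (.const 2) (hD.computable_condExponent.comp .fst))
      (computable_mul (computable_pow (.const 2) .fst)
        (computable_add (computable_sub hX hY) (computable_sub hY hX)))
  have hΛ : Computable fun k => L k + L (k + 1) :=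
    computable_add hD.computable_length (hD.computable_length.comp .succ)
  have habs : ∀ a b : ℕ, (((a - b) + (b - a) : ℕ) : ℝ) = |(a : ℝ) - b| := by
    intro a b
    rcases le_total a b with hab | hab
    · rw [Nat.sub_eq_zero_of_le hab, zero_add, Nat.cast_sub hab, abs_sub_comm, abs_of_nonneg]
      exact sub_nonneg.2 (Nat.cast_le.2 hab)
    · rw [Nat.sub_eq_zero_of_le hab, add_zero, Nat.cast_sub hab, abs_of_nonneg]
      exact sub_nonneg.2 (Nat.cast_le.2 hab)
  have hiff : ∀ k ξ, P k (pre (L k + L (k + 1)) ξ) = true ↔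
      (1 / 2) ^ k < |stepFun L G k ξ - condExpAt k (stepFun L G (k + 1)) ξ| := by
    intro k ξ
    have h1 : stepFun L G k ξ = X k (pre (L k + L (k + 1)) ξ) / 2 ^ condExponent L k := by
      have hexp : condExponent L k = 2 * k + 4 + (2 + L (k + 1)) := by rw [condExponent]; ring
      simp only [X]
      rw [hD.value_pre k _ ξ (Nat.le_add_right _ _), hexp, pow_add _ (2 * k + 4), stepFun]
      push_cast
      rw [mul_div_mul_right _ _ (by positivity)]
    rw [h1, condExpAt_stepFun (Nat.le_add_left (L (k + 1)) (L k)), ← sub_div, abs_div,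
      abs_of_pos (by positivity : (0 : ℝ) < 2 ^ condExponent L k), ← habs, one_div, inv_pow,
      ← one_div, div_lt_div_iff₀ (by positivity) (by positivity), decide_eq_true_eq, one_mul,
      mul_comm (2 ^ k)]
    exact_mod_cast Iff.rfl
  obtain ⟨k, hk⟩ := hω.eventually_not hP hΛ fun k => by
    have hF : ∀ n, Integrable (fun ω => M n ω + 1) unif := fun n =>
      (hM.integrable n).add (integrable_const 1)
    have hE : ∀ᵐ ω ∂unif, condExpAt k (fun ω => M (k + 1) ω + 1) ω = M k ω + 1 := by
      filter_upwards [hM.condExp k (k + 1) (Nat.le_succ k),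
        ae_integrable_concat k (hM.integrable (k + 1))] with ω h1 h2
      rw [← h1, condExpAt, integral_add h2 (integrable_const 1)]
      simp [condExpAt]
    refine stringCount_le_of_integral_le (ε := (1 / 2) ^ k)
      ((integrable_stepFun k).sub (integrable_condExpAt k (integrable_stepFun (k + 1)))).abs
      (.of_forall fun ω => abs_nonneg _) (by positivity)
      (.of_forall fun ω h => ((hiff k ω).1 h).le) ?_
    refine (integral_abs_sub_condExpAt_le k (hF k) (hF (k + 1)) (integrable_stepFun k)
      (integrable_stepFun (k + 1)) (h.ae_le k) (h.ae_le (k + 1)) hE).trans ?_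
    refine (add_le_add (h.integral_le k) (h.integral_le (k + 1))).trans ?_
    have e1 : (2 : ℝ) ^ (2 * k + 4) = 2 ^ k * 2 ^ k * 16 := by ring
    have e2 : (2 : ℝ) ^ (2 * (k + 1) + 4) = 2 ^ k * 2 ^ k * 64 := by ring
    have e3 : (1 / 2 : ℝ) ^ k * (1 / 2) ^ k = 1 / (2 ^ k * 2 ^ k) := by
      rw [one_div, inv_pow]; field_simp
    have h2 : (0 : ℝ) < 2 ^ k * 2 ^ k := by positivity
    rw [e1, e2, e3]
    generalize (2 : ℝ) ^ k * 2 ^ k = t at h2 ⊢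
    rw [← sub_nonneg]
    have : 1 / t - (7 / (t * 16) + 7 / (t * 64)) = 29 / 64 / t := by field_simp; norm_num
    rw [this]
    positivity
  refine Summable.of_norm_bounded_eventually_nat summable_geometric_two ?_
  filter_upwards [eventually_ge_atTop k] with n hn
  have h1 := hk n hn
  rw [← Bool.not_eq_true, hiff, not_lt] at h1
  simpa using h1

/-- At `ω` the machine produces a name and the step function is eventually nonzero, so `dist_le`
applies and `M n ω + 1 - stepFun L G n ω` tends to 0. -/
theorem Approximates.not_converges (h : Approximates φ M L G) (hφ : ComputesAE φ M)
    (hM : IsMartingale M) (h0 : ∀ n ξ, 0 ≤ M n ξ) (hω : IsSchnorrRandom ω)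
    (hd : ¬ Converges fun n => M n ω) : ¬ Converges fun n => stepFun L G n ω := by
  rintro ⟨l, hl⟩
  have h1 : Tendsto (fun n => M n ω + 1 - stepFun L G n ω) atTop (𝓝 0) := by
    have hb : Tendsto (fun n : ℕ => 3 * (1 / 2 : ℝ) ^ n) atTop (𝓝 0) := by
      simpa using (tendsto_pow_atTop_nhds_zero_of_lt_one (by norm_num : (0 : ℝ) ≤ 1 / 2)
        (by norm_num)).const_mul 3
    refine squeeze_zero_norm' ?_ hb
    filter_upwards [h.eventually_ne_zero hM h0 hω] with n hn
    obtain ⟨x, hx⟩ := hφ.exists_produces hω n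
    refine (h.dist_le n ω x hx hn).trans ?_
    rw [one_div, inv_pow, ← div_eq_mul_inv]
    exact div_le_div_of_nonneg_left (by norm_num) (by positivity)
      (pow_le_pow_right₀ one_le_two (by omega))
  refine hd ⟨0 + l - 1, ((h1.add hl).sub_const 1).congr fun n => ?_⟩
  ring

end

/-! ### Passing between computable and a.e. computable martingales -/

theorem IsComputableMartingale.isAEComputableMartingale {M : ℕ → CantorSeq → ℝ}
    (h : IsComputableMartingale M) : IsAEComputableMartingale M := by
  obtain ⟨hM, φ, hφ, hx⟩ := h
  refine ⟨hM, φ, hφ, fun n => .of_forall fun ω => ?_, fun n ω x h => ?_⟩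
  · obtain ⟨x, h, _⟩ := hx n ω
    exact ⟨x, h⟩
  · obtain ⟨y, hy, hy'⟩ := hx n ω
    rwa [h.unique hy]

/-- A nonnegative a.e. computable martingale that diverges at a Schnorr random point can be replaced
by a computable one with a computable bound. -/
theorem IsAEComputableMartingale.exists_bounded {M : ℕ → CantorSeq → ℝ}
    (h : IsAEComputableMartingale M) (h0 : ∀ n ξ, 0 ≤ M n ξ) {ω : CantorSeq}
    (hω : IsSchnorrRandom ω) (hd : ¬ Converges fun n => M n ω) :
    ∃ (N : ℕ → CantorSeq → ℝ) (d : ℕ → ℝ), IsComputableMartingale N ∧ (∀ n ξ, 0 ≤ N n ξ) ∧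
      IsComputableRealSeq d ∧ (∀ n ξ, |N n ξ| ≤ d n) ∧ ¬ Converges fun n => N n ω := by
  obtain ⟨hM, φ, hφm, hφa, hφn⟩ := h
  have hφ : ComputesAE φ M := ⟨hφm, hφa, hφn⟩
  obtain ⟨L, G, hG⟩ := hφ.exists_approximates hM h0
  obtain ⟨C, hC⟩ := exists_compensated_not_converges (hG.summable hM hω)
    (hG.not_converges hφ hM h0 hω hd)
  obtain ⟨d, hd, hb⟩ := hG.isStepData.exists_bound C
  exact ⟨_, d, hG.isStepData.isComputableMartingale C,
    compensated_nonneg (Nat.cast_nonneg C) stepFun_nonneg, hd, hb, hC⟩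

end DoobRandom

theorem mainTheorem10 (ω : DoobRandom.CantorSeq) (hω : DoobRandom.IsSchnorrRandom ω) :
    List.TFAE [
      ∃ (M : ℕ → DoobRandom.CantorSeq → ℝ) (d : ℕ → ℝ),
        DoobRandom.IsComputableMartingale M ∧ (∀ n ξ, 0 ≤ M n ξ) ∧
        DoobRandom.IsComputableRealSeq d ∧ (∀ n ξ, |M n ξ| ≤ d n) ∧
        ¬ DoobRandom.Converges (fun n => M n ω),
      ¬ DoobRandom.IsDoobRandom ω,
      ∃ M : ℕ → DoobRandom.CantorSeq → ℝ,
        DoobRandom.IsAEComputableMartingale M ∧ (∀ n ξ, 0 ≤ M n ξ) ∧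
        ¬ DoobRandom.Converges (fun n => M n ω)] := by
  tfae_have 1 → 2 := fun ⟨M, _, hM, h0, _, _, hd⟩ h => hd (h M hM h0)
  tfae_have 2 → 3 := by
    intro h
    simp only [DoobRandom.IsDoobRandom, not_forall] at h
    obtain ⟨M, hM, h0, hd⟩ := h
    exact ⟨M, hM.isAEComputableMartingale, h0, hd⟩
  tfae_have 3 → 1 := fun ⟨_, hM, h0, hd⟩ => hM.exists_bounded h0 hω hd
  tfae_finish
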